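/- Let $\omega\ge 0$ and let $G$ be a linear time-invariant system $\dot x=Ax+Bu$, $y=Cx+Du$ with real matrices $A\in\mathbb R^{n\times n}$, $B\in\mathbb R^{n\times m}$, $C\in\mathbb R^{p\times n}$, $D\in\mathbb R^{p\times m}$, with $A$ Hurwitz (all eigenvalues have negative real part). Write $G(s)=C(sI-A)^{-1}B+D$, $H(\nu)=(i\nu I-A)^{-1}$, and let $$\|F\|_{\mathcal H_2,\omega}=\Bigl(\tfrac1{2\pi}\operatorname{tr}\int_{-\omega}^{\omega}F(i\nu)F(i\nu)^{H}\,d\nu\Bigr)^{1/2}$$ for a transfer function $F$. Put $$P_\omega=\tfrac1{2\pi}\int_{-\omega}^{\omega}H(\nu)BB^TH(\nu)^H\,d\nu,\qquad Q_\omega=\tfrac1{2\pi}\int_{-\omega}^{\omega}H(\nu)^HC^TCH(\nu)\,d\nu,\qquad S_\omega=\tfrac{i}{2\pi}\ln\bigl((A+i\omega I)(A-i\omega I)^{-1}\bigr),$$ where $\ln$ is the principal matrix logarithm: $\ln M$ is the unique $L$ with $e^L=M$ all of whose eigenvalues satisfy $-\pi<\operatorname{Im}z<\pi$. The logarithm in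 $S_\omega$ exists and is unique, $P_\omega$ is the unique solution of $$AP_\omega+P_\omega A^T+S_\omega BB^T+BB^TS_\omega^H=0,$$ and $$\|G\|_{\mathcal H_2,\omega}^2=\tfrac1{2\pi}\operatorname{tr}\int_{-\omega}^{\omega}G(i\nu)G(i\nu)^H\,d\nu=\tfrac1{2\pi}\operatorname{tr}\int_{-\omega}^{\omega}(CH(\nu)B+D)(B^TH(\nu)^HC^T+D^T)\,d\nu=\operatorname{tr}CP_\omega C^T+2\operatorname{tr}\Bigl[\bigl(CS_\omega B+D\tfrac{\omega}{2\pi}\bigr)D^T\Bigr].$$ Let further $\hat G$ be a system with matrices $\hat A\in\mathbb R^{r\times r}$ (Hurwitz), $\hat B\in\mathbb R^{r\times m}$, $\hat C\in\mathbb R^{p\times r}$, $\hat D\in\mathbb R^{p\times m}$, and let $\hat P_\omega,\hat Q_\omega,\hat S_\omega$ be formed from it in the same way. Let $E$ be the system with $$A_E=\begin{pmatrix}A&0\\0&\hat A\end{pmatrix},\quad B_E=\begin{pmatrix}B\\\hat B\end{pmatrix},\quad C_E=\begin{pmatrix}C&-\hat C\end{pmatrix},\quad D_E=D-\hat D,$$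 let $P_{E,\omega},Q_{E,\omega},S_{E,\omega}$ be formed from it in the same way, and let $X_\omega$ and $Y_\omega$ be the upper right ($n\times r$) blocks of $P_{E,\omega}$ and $Q_{E,\omega}$. Then $E(i\nu)=G(i\nu)-\hat G(i\nu)$ for all real $\nu$, the logarithms in $\hat S_\omega$ and $S_{E,\omega}$ exist and are unique, and $$P_{E,\omega}=\begin{pmatrix}P_\omega&X_\omega\\X_\omega^T&\hat P_\omega\end{pmatrix},\quad Q_{E,\omega}=\begin{pmatrix}Q_\omega&Y_\omega\\Y_\omega^T&\hat Q_\omega\end{pmatrix},\quad S_{E,\omega}=\begin{pmatrix}S_\omega&0\\0&\hat S_\omega\end{pmatrix}.$$ The matrices $X_\omega,\hat P_\omega,Q_\omega,Y_\omega,\hat Q_\omega$ are the unique solutions, respectively, of $$AX_\omega+X_\omega\hat A^T+S_\omega B\hat B^T+B\hat B^T\hat S_\omega^H=0,\qquad \hat A\hat P_\omega+\hat P_\omega\hat A^T+\hat S_\omega\hat B\hat B^T+\hat B\hat B^T\hat S_\omega^H=0,$$ $$A^TQ_\omega+Q_\omega A+S_\omega^HC^TC+C^TCS_\omega=0,\qquad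 A^TY_\omega+Y_\omega\hat A-S_\omega^HC^T\hat C-C^T\hat C\hat S_\omega=0,$$ $$\hat A^T\hat Q_\omega+\hat Q_\omega\hat A+\hat S_\omega^H\hat C^T\hat C+\hat C^T\hat C\hat S_\omega=0.$$ Finally $\|E\|_{\mathcal H_2,\omega}=\|G-\hat G\|_{\mathcal H_2,\omega}$, and $$\|E\|_{\mathcal H_2,\omega}^2=\tfrac1{2\pi}\operatorname{tr}\int_{-\omega}^{\omega}E(i\nu)E(i\nu)^H\,d\nu=\operatorname{tr}C_EP_{E,\omega}C_E^T+2\operatorname{tr}\Bigl[\bigl(C_ES_{E,\omega}B_E+D_E\tfrac{\omega}{2\pi}\bigr)D_E^T\Bigr]=\operatorname{tr}B_E^TQ_{E,\omega}B_E+2\operatorname{tr}\Bigl[\bigl(C_ES_{E,\omega}B_E+D_E\tfrac{\omega}{2\pi}\bigr)D_E^T\Bigr],$$ $$\|E\|_{\mathcal H_2,\omega}^2=\operatorname{tr}\bigl(B^TQ_\omega B+2B^TY_\omega\hat B+\hat B^T\hat Q_\omega\hat B\bigr)+2\operatorname{tr}\Bigl[\bigl(CS_\omega B+D\tfrac{\omega}{2\pi}-(\hat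 C\hat S_\omega\hat B+\hat D\tfrac{\omega}{2\pi})\bigr)(D^T-\hat D^T)\Bigr],$$ $$\|E\|_{\mathcal H_2,\omega}^2=\operatorname{tr}\bigl(CP_\omega C^T-2CX_\omega\hat C^T+\hat C\hat P_\omega\hat C^T\bigr)+2\operatorname{tr}\Bigl[\bigl(CS_\omega B+D\tfrac{\omega}{2\pi}-(\hat C\hat S_\omega\hat B+\hat D\tfrac{\omega}{2\pi})\bigr)(D^T-\hat D^T)\Bigr].$$ -/

import Mathlib

open scoped Matrix

noncomputable section

namespace FreqLim

/-- A real matrix, viewed as a complex one. -/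
def toC {a b : Type*} (M : Matrix a b ℝ) : Matrix a b ℂ :=
  M.map (fun x : ℝ => (x : ℂ))

/-- The entrywise integral of a matrix-valued function over the band from `-ω` to `ω`. -/
def bandIntegral {a b : Type*} (ω : ℝ) (F : ℝ → Matrix a b ℂ) : Matrix a b ℂ :=
  Matrix.of fun i j => ∫ ν in (-ω)..ω, F ν i j

/-- `L` is a principal logarithm of `M`: `exp L = M` and all eigenvalues of `L` lie in the open
strip `-π < Im z < π`. -/
def IsPrincipalLog {n : Type*} [Fintype n] [DecidableEq n] (M L : Matrix n n ℂ) : Prop :=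
  NormedSpace.exp L = M ∧ ∀ z ∈ spectrum ℂ L, -Real.pi < z.im ∧ z.im < Real.pi

open Classical in
/-- The principal matrix logarithm (with value `0` if no principal logarithm exists). -/
def matrixLog {n : Type*} [Fintype n] [DecidableEq n] (M : Matrix n n ℂ) : Matrix n n ℂ :=
  if h : ∃ L, IsPrincipalLog M L then h.choose else 0

/-- A real linear time-invariant system `x' = A x + B u`, `y = C x + D u` with states indexed by
`n`, inputs by `m` and outputs by `p`. -/
structure LTISystem (n m p : Type*) where
  A : Matrix n n ℝ
  B : Matrix n m ℝ
  C : Matrix p n ℝ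
  D : Matrix p m ℝ

/-- A real square matrix is Hurwitz if all its complex eigenvalues have negative real part. -/
def IsHurwitz {n : Type*} [Fintype n] [DecidableEq n] (A : Matrix n n ℝ) : Prop :=
  ∀ z ∈ spectrum ℂ (toC A), z.re < 0

/-- The matrix `(A + iωI)(A - iωI)⁻¹`. -/
def cayley {n : Type*} [Fintype n] [DecidableEq n] (ω : ℝ) (A : Matrix n n ℝ) : Matrix n n ℂ :=
  (toC A + (Complex.I * (ω : ℂ)) • (1 : Matrix n n ℂ)) *
    (toC A - (Complex.I * (ω : ℂ)) • (1 : Matrix n n ℂ))⁻¹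

/-- `S_ω = (i / 2π) ln ((A + iωI)(A - iωI)⁻¹)`. -/
def logS {n : Type*} [Fintype n] [DecidableEq n] (ω : ℝ) (A : Matrix n n ℝ) : Matrix n n ℂ :=
  (Complex.I / (2 * (Real.pi : ℂ))) • matrixLog (cayley ω A)

/-- `H(ν) = (iνI - A)⁻¹`. -/
def resolventH {n : Type*} [Fintype n] [DecidableEq n] (A : Matrix n n ℝ) (ν : ℝ) :
    Matrix n n ℂ :=
  ((Complex.I * (ν : ℂ)) • (1 : Matrix n n ℂ) - toC A)⁻¹

/-- The frequency-limited `H₂` norm of a transfer function `F`: the nonnegative number with square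
`(1 / 2π) tr ∫_{-ω}^{ω} F(iν) F(iν)ᴴ dν`. -/
def freqNorm {m p : Type*} [Fintype m] [Fintype p] (ω : ℝ) (F : ℂ → Matrix p m ℂ) : ℝ :=
  Real.sqrt (1 / (2 * Real.pi) *
    (bandIntegral ω fun ν : ℝ => F (Complex.I * (ν : ℂ)) * (F (Complex.I * (ν : ℂ)))ᴴ).trace.re)

namespace LTISystem

/-- The system is stable: `A` is Hurwitz. -/
def IsStable {n m p : Type*} [Fintype n] [DecidableEq n] (G : LTISystem n m p) : Prop :=
  IsHurwitz G.A

/-- The transfer function `s ↦ C (sI - A)⁻¹ B + D`. -/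
def transfer {n m p : Type*} [Fintype n] [DecidableEq n] (G : LTISystem n m p) (s : ℂ) :
    Matrix p m ℂ :=
  toC G.C * (s • (1 : Matrix n n ℂ) - toC G.A)⁻¹ * toC G.B + toC G.D

/-- The frequency-limited controllability Gramian
`P_ω = (1 / 2π) ∫_{-ω}^{ω} H(ν) B Bᵀ H(ν)ᴴ dν`. -/
def ctrlGramian {n m p : Type*} [Fintype n] [DecidableEq n] [Fintype m]
    (G : LTISystem n m p) (ω : ℝ) : Matrix n n ℂ :=
  (1 / (2 * (Real.pi : ℂ))) • bandIntegral ω fun ν : ℝ =>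
    resolventH G.A ν * toC G.B * (toC G.B)ᵀ * (resolventH G.A ν)ᴴ

/-- The frequency-limited observability Gramian
`Q_ω = (1 / 2π) ∫_{-ω}^{ω} H(ν)ᴴ Cᵀ C H(ν) dν`. -/
def obsGramian {n m p : Type*} [Fintype n] [DecidableEq n] [Fintype p]
    (G : LTISystem n m p) (ω : ℝ) : Matrix n n ℂ :=
  (1 / (2 * (Real.pi : ℂ))) • bandIntegral ω fun ν : ℝ =>
    (resolventH G.A ν)ᴴ * (toC G.C)ᵀ * toC G.C * resolventH G.A ν

/-- The block-diagonal realization of the error system `G - Ĝ`. -/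
def errorSystem {n r m p : Type*} (G : LTISystem n m p) (Gr : LTISystem r m p) :
    LTISystem (n ⊕ r) m p where
  A := Matrix.fromBlocks G.A 0 0 Gr.A
  B := Matrix.fromRows G.B Gr.B
  C := Matrix.fromCols G.C (-Gr.C)
  D := G.D - Gr.D

/-- The off-diagonal block `X_ω` of the controllability Gramian of the error system. -/
def crossX {n r m p : Type*} [Fintype n] [DecidableEq n] [Fintype r] [DecidableEq r] [Fintype m]
    (G : LTISystem n m p) (Gr : LTISystem r m p) (ω : ℝ) : Matrix n r ℂ :=
  ((G.errorSystem Gr).ctrlGramian ω).toBlocks₁₂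

/-- The off-diagonal block `Y_ω` of the observability Gramian of the error system. -/
def crossY {n r m p : Type*} [Fintype n] [DecidableEq n] [Fintype r] [DecidableEq r] [Fintype p]
    (G : LTISystem n m p) (Gr : LTISystem r m p) (ω : ℝ) : Matrix n r ℂ :=
  ((G.errorSystem Gr).obsGramian ω).toBlocks₁₂

end LTISystem

end FreqLim

end

/-! Everything rests on replacing the logarithm by an integral: `S_ω = (1/2π) ∫ H(ν) dν` over the
band (`IsHurwitz.logS_eq`). Put `L(ω) = -i ∫ H(ν) dν`. The product `exp(-L(ω)) (A + iωI) H(ω)` has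
zero derivative in `ω` and equals `-I` at `0`, so `exp L(ω)` is the Cayley quotient. `L(ω)` commutes
with `A`, so each of its eigenvalues is a scalar integral over the band of `-i (iν - l)⁻¹` with `l`
an eigenvalue of `A`; its imaginary part is, up to sign, a difference of two arctangents, hence lies
strictly between `-π` and `π`. Thus `L(ω)` is a principal logarithm, and `IsPrincipalLog.unique`
makes it the only one.

With `S_ω` an integral, the matrix equations hold pointwise in `ν`: as `A H = iν H - I`, the terms
carrying `iν` cancel in `A (H M Ĥᴴ) + (H M Ĥᴴ) Âᵀ`, leaving `-(M Ĥᴴ + H M)`. Uniqueness holds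
because a nonzero solution of `A Z + Z B = 0` would give `A` and `-B` a common eigenvalue.

For the norm, expand `G Gᴴ` (or `Gᴴ G`, with the same trace) into four terms. Since the data are
real, `conj H(ν) = H(-ν)`, and the band is symmetric, so `S_ωᴴ = S_ωᵀ` and the two mixed terms have
equal traces; this is the factor `2`. The same symmetry makes the lower left blocks of the error
Gramians transposes of the upper right ones. The error formulas are those of a single system applied
to the block-diagonal realization. -/

namespace FreqLim

/-! ### Intertwining matrices and Sylvester equations. -/

section Sylvester

variable {n r : Type*} [Fintype n] [DecidableEq n] [Fintype r] [DecidableEq r]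

/-- Two matrices intertwined by a nonzero matrix have a common eigenvalue. -/
theorem exists_common_eigenvalue {A : Matrix n n ℂ} {B : Matrix r r ℂ} {X : Matrix n r ℂ}
    (h : A * X = X * B) (hX : X ≠ 0) : ∃ z, z ∈ spectrum ℂ A ∧ z ∈ spectrum ℂ B := by
  have hpow : ∀ k : ℕ, A ^ k * X = X * B ^ k := by
    intro k
    induction k with
    | zero => simp
    | succ k ih => rw [pow_succ', Matrix.mul_assoc, ih, ← Matrix.mul_assoc, h, Matrix.mul_assoc,
        ← pow_succ']
  have hpoly : ∀ q : Polynomial ℂ, Polynomial.aeval A q * X = X * Polynomial.aeval B q := by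
    intro q
    induction q using Polynomial.induction_on' with
    | add p q hp hq => simp only [map_add, Matrix.add_mul, Matrix.mul_add, hp, hq]
    | monomial k a =>
      simp only [Polynomial.aeval_monomial, Algebra.algebraMap_eq_smul_one, smul_mul_assoc, one_mul,
        Matrix.smul_mul, Matrix.mul_smul, hpow]
  -- By Cayley–Hamilton for `B`, `charpoly B` evaluated at `A` annihilates `X ≠ 0`, so it is
  -- singular; spectral mapping then yields an eigenvalue of `A` that is a root of `charpoly B`.
  have hzero : Polynomial.aeval A B.charpoly * X = 0 := by
    rw [hpoly, Matrix.aeval_self_charpoly, Matrix.mul_zero]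
  have hnu : ¬ IsUnit (Polynomial.aeval A B.charpoly) := by
    rintro ⟨u, hu⟩
    apply hX
    calc X = (↑u⁻¹ * ↑u : Matrix n n ℂ) * X := by simp
      _ = 0 := by rw [hu, Matrix.mul_assoc, hzero, Matrix.mul_zero]
  have hne : Nonempty n := by
    by_contra hn
    rw [not_nonempty_iff] at hn
    exact hX (Subsingleton.elim _ _)
  have h0 : (0 : ℂ) ∈ spectrum ℂ (Polynomial.aeval A B.charpoly) :=
    spectrum.zero_mem_iff ℂ |>.2 hnu
  rw [spectrum.map_polynomial_aeval_of_nonempty A _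
    (spectrum.nonempty_of_isAlgClosed_of_finiteDimensional ℂ A)] at h0
  obtain ⟨z, hz, hz0⟩ := h0
  exact ⟨z, hz, Matrix.mem_spectrum_iff_isRoot_charpoly.2 hz0⟩

/-- The homogeneous Sylvester equation with coefficients in the open left half plane has only the
zero solution. -/
theorem sylvester_eq_zero {A : Matrix n n ℂ} {B : Matrix r r ℂ} {Z : Matrix n r ℂ}
    (hA : ∀ z ∈ spectrum ℂ A, z.re < 0) (hB : ∀ z ∈ spectrum ℂ B, z.re < 0)
    (h : A * Z + Z * B = 0) : Z = 0 := by
  by_contra hZ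
  -- `Z` intertwines `A` with `-B`, whose spectra lie in opposite open half planes.
  obtain ⟨z, hz, hz'⟩ := exists_common_eigenvalue (A := A) (B := -B) (X := Z)
    (by rw [Matrix.mul_neg]; exact eq_neg_of_add_eq_zero_left h) hZ
  rw [← spectrum.neg_eq, Set.mem_neg] at hz'
  have h1 := hA _ hz
  have h2 := hB _ hz'
  simp at h2
  linarith

/-- Commuting matrices have a common eigenvector for every eigenvalue of the first. -/
theorem exists_common_eigenvector {A L : Matrix n n ℂ} (h : Commute L A) {z : ℂ}
    (hz : z ∈ spectrum ℂ L) :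
    ∃ v : n → ℂ, v ≠ 0 ∧ L *ᵥ v = z • v ∧ ∃ l ∈ spectrum ℂ A, A *ᵥ v = l • v := by
  have hev : Module.End.HasEigenvalue (Matrix.toLin' L) z := by
    rw [Module.End.hasEigenvalue_iff_mem_spectrum, Matrix.spectrum_toLin']
    exact hz
  -- `A` preserves the eigenspace of the commuting matrix `L`; an eigenvector of the restriction
  -- serves both.
  have hmap : ∀ x ∈ Module.End.eigenspace (Matrix.toLin' L) z,
      Matrix.toLin' A x ∈ Module.End.eigenspace (Matrix.toLin' L) z := by
    intro x hx
    rw [Module.End.mem_eigenspace_iff] at hx ⊢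
    rw [Matrix.toLin'_apply] at hx
    rw [Matrix.toLin'_apply, Matrix.toLin'_apply, Matrix.mulVec_mulVec, h.eq,
      ← Matrix.mulVec_mulVec, hx, Matrix.mulVec_smul]
  have : Nontrivial (Module.End.eigenspace (Matrix.toLin' L) z) :=
    Submodule.nontrivial_iff_ne_bot.2 hev
  obtain ⟨l, hl⟩ := Module.End.exists_eigenvalue ((Matrix.toLin' A).restrict hmap)
  obtain ⟨w, hw⟩ := hl.exists_hasEigenvector
  have hw0 : (w : n → ℂ) ≠ 0 := fun h0 => hw.2 (Subtype.ext h0)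
  have hAw : Matrix.toLin' A (w : n → ℂ) = l • (w : n → ℂ) := congrArg Subtype.val hw.apply_eq_smul
  have hLw := Module.End.mem_eigenspace_iff.1 w.2
  refine ⟨w, hw0, by simpa using hLw, l, ?_, by simpa using hAw⟩
  rw [← Matrix.spectrum_toLin', ← Module.End.hasEigenvalue_iff_mem_spectrum]
  exact Module.End.hasEigenvalue_of_hasEigenvector
    ⟨Module.End.mem_eigenspace_iff.2 hAw, hw0⟩

end Sylvester

/-! ### Exponentials in a complex Banach algebra. -/

section ExpAlgebra

variable {R : Type*} [NormedRing R] [NormedAlgebra ℂ R] [CompleteSpace R]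

theorem exp_mul_eq_mul_exp {a b x : R} (h : a * x = x * b) :
    NormedSpace.exp a * x = x * NormedSpace.exp b := by
  have hpow : ∀ k : ℕ, a ^ k * x = x * b ^ k := by
    intro k
    induction k with
    | zero => simp
    | succ k ih => rw [pow_succ', mul_assoc, ih, ← mul_assoc, h, mul_assoc, ← pow_succ']
  have h1 := (NormedSpace.exp_series_hasSum_exp' (𝕂 := ℂ) a).mul_right x
  have h2 := (NormedSpace.exp_series_hasSum_exp' (𝕂 := ℂ) b).mul_left x
  refine h1.unique ?_
  convert h2 using 2 with k
  rw [smul_mul_assoc, hpow, mul_smul_comm]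

/-- If `a u - u b` intertwines `a` and `b`, then `exp a u = (u + (a u - u b)) exp b`. -/
theorem exp_mul_of_sub_intertwines {a b u x : R} (hu : a * u - u * b = x) (hx : a * x = x * b) :
    NormedSpace.exp a * u = (u + x) * NormedSpace.exp b := by
  let : NormedAlgebra ℚ R := NormedAlgebra.restrictScalars ℚ ℂ R
  have hcancel : ∀ t : ℂ, NormedSpace.exp (t • b) * NormedSpace.exp (-t • b) = 1 := by
    intro t
    rw [← NormedSpace.exp_add_of_commute (((Commute.refl b).smul_left t).smul_right (-t))]
    simp
  -- The function `exp(ta) u exp(-tb) - t x` is constant: its derivative is `exp(ta) x exp(-tb) -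
  -- x`, and `x` intertwines the two exponentials. The claim compares its values at `1` and `0`.
  have hd : ∀ t : ℂ, HasDerivAt (fun t : ℂ =>
      NormedSpace.exp (t • a) * u * NormedSpace.exp (-t • b) - t • x) 0 t := by
    intro t
    have h1 := (hasDerivAt_exp_smul_const (𝕂 := ℂ) a t).mul_const u
    have h2 := (hasDerivAt_exp_smul_const' (𝕂 := ℂ) b (-t)).scomp t (hasDerivAt_neg t)
    have h3 := (h1.mul h2).sub ((hasDerivAt_id t).smul_const x)
    refine h3.congr_deriv ?_
    have h4 : NormedSpace.exp (t • a) * x = x * NormedSpace.exp (t • b) :=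
      exp_mul_eq_mul_exp (by rw [smul_mul_assoc, hx, mul_smul_comm])
    simp only [Function.comp, one_smul, neg_smul, one_smul, mul_neg]
    have : NormedSpace.exp (t • a) * a * u * NormedSpace.exp (-(t • b))
        + -(NormedSpace.exp (t • a) * u * (b * NormedSpace.exp (-(t • b))))
        = NormedSpace.exp (t • a) * (a * u - u * b) * NormedSpace.exp (-(t • b)) := by
      noncomm_ring
    rw [this, hu, h4, mul_assoc, ← neg_smul, hcancel, mul_one, sub_self]
  have h01 := is_const_of_deriv_eq_zero (fun t => (hd t).differentiableAt)
    (fun t => (hd t).deriv) 1 0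
  simp only [one_smul, neg_smul, zero_smul, neg_zero, NormedSpace.exp_zero, one_mul, mul_one,
    sub_zero] at h01
  have h5 := hcancel (-1)
  simp only [neg_neg, neg_smul, one_smul] at h5
  rw [← sub_eq_iff_eq_add.1 h01, mul_assoc, h5, mul_one]

/-- Derivative of the exponential along a commuting path. -/
theorem hasDerivAt_exp_of_commute {f : ℝ → R} {f' : R} {t : ℝ} (hf : HasDerivAt f f' t)
    (hc : ∀ s, Commute (f s) (f t)) :
    HasDerivAt (fun s => NormedSpace.exp (f s)) (NormedSpace.exp (f t) * f') t := by
  let : NormedAlgebra ℚ R := NormedAlgebra.restrictScalars ℚ ℂ R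
  -- Since `exp (f s) = exp (f t) exp (f s - f t)`, only the derivative of `exp` at `0` is needed.
  have h0 : HasFDerivAt (𝕜 := ℝ) NormedSpace.exp (1 : R →L[ℝ] R) (f t - f t) := by
    rw [sub_self]
    exact hasFDerivAt_exp_zero (𝕂 := ℝ)
  have h1 : HasDerivAt (fun s => NormedSpace.exp (f s - f t)) f' t := by
    exact h0.comp_hasDerivAt t (hf.sub_const (f t))
  refine (h1.const_mul (NormedSpace.exp (f t))).congr_of_eventuallyEq
    (Filter.Eventually.of_forall fun s => ?_)
  dsimp only
  rw [← NormedSpace.exp_add_of_commute, add_sub_cancel]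
  exact (hc s).symm.sub_right (Commute.refl _)

end ExpAlgebra

/-! ### Uniqueness of the principal logarithm. -/

section Log

variable {n : Type*} [Fintype n] [DecidableEq n]

theorem matrix_exp_mul_eq_mul_exp {a b x : Matrix n n ℂ} (h : a * x = x * b) :
    NormedSpace.exp a * x = x * NormedSpace.exp b := by
  let : NormedRing (Matrix n n ℂ) := Matrix.linftyOpNormedRing
  let : NormedAlgebra ℂ (Matrix n n ℂ) := Matrix.linftyOpNormedAlgebra
  exact exp_mul_eq_mul_exp h

theorem matrix_exp_mul_of_sub_intertwines {a b u x : Matrix n n ℂ} (hu : a * u - u * b = x)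
    (hx : a * x = x * b) : NormedSpace.exp a * u = (u + x) * NormedSpace.exp b := by
  let : NormedRing (Matrix n n ℂ) := Matrix.linftyOpNormedRing
  let : NormedAlgebra ℂ (Matrix n n ℂ) := Matrix.linftyOpNormedAlgebra
  exact exp_mul_of_sub_intertwines hu hx

theorem matrix_exp_add_algebraMap (a : Matrix n n ℂ) (z : ℂ) :
    NormedSpace.exp (a + algebraMap ℂ _ z) = Complex.exp z • NormedSpace.exp a := by
  have h : algebraMap ℂ (Matrix n n ℂ) (NormedSpace.exp z)
      = NormedSpace.exp (algebraMap ℂ (Matrix n n ℂ) z) := by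
    let : NormedRing (Matrix n n ℂ) := Matrix.linftyOpNormedRing
    let : NormedAlgebra ℂ (Matrix n n ℂ) := Matrix.linftyOpNormedAlgebra
    exact NormedSpace.algebraMap_exp_comm z
  rw [Matrix.exp_add_of_commute _ _ (Algebra.commutes z a).symm, ← h, Complex.exp_eq_exp_ℂ,
    Algebra.algebraMap_eq_smul_one, mul_smul_comm, mul_one]

/-- The Sylvester operator `T X = L₁ X - X L₂` acts on the commutant `E` of `M`. If `L₁ ≠ L₂`, then
`T 1 ≠ 0`, so `T` has an eigenvector `w` in `T(E)`. The strip condition forces its eigenvalue to be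
`0`, and then `w = T U` behaves like a Jordan chain of length two, which exponentiation would detect
although `U` commutes with `M`. -/
theorem IsPrincipalLog.unique {M L₁ L₂ : Matrix n n ℂ} (h₁ : IsPrincipalLog M L₁)
    (h₂ : IsPrincipalLog M L₂) : L₁ = L₂ := by
  by_contra hne
  let T : Module.End ℂ (Matrix n n ℂ) := LinearMap.mulLeft ℂ L₁ - LinearMap.mulRight ℂ L₂
  have hT : ∀ X, T X = L₁ * X - X * L₂ := fun X => rfl
  have hM : IsUnit M := h₁.1 ▸ Matrix.isUnit_exp L₁
  let E : Submodule ℂ (Matrix n n ℂ) :=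
    LinearMap.ker (LinearMap.mulLeft ℂ M - LinearMap.mulRight ℂ M)
  have hE : ∀ X, X ∈ E ↔ M * X = X * M := by
    intro X
    simp [E, sub_eq_zero]
  have hc₁ : L₁ * M = M * L₁ := by
    rw [← h₁.1]; exact (matrix_exp_mul_eq_mul_exp rfl).symm
  have hc₂ : L₂ * M = M * L₂ := by
    rw [← h₂.1]; exact (matrix_exp_mul_eq_mul_exp rfl).symm
  have hTE : ∀ X ∈ E, T X ∈ E := by
    intro X hX
    rw [hE] at hX ⊢
    rw [hT, mul_sub, sub_mul, ← mul_assoc, ← hc₁, mul_assoc, hX, mul_assoc, mul_assoc, hc₂,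
      ← mul_assoc M, hX, mul_assoc]
  -- Working in the image `T(E)` rather than in `E` supplies the preimage `U` of the eigenvector,
  -- used at the end.
  let W : Submodule ℂ (Matrix n n ℂ) := E.map T
  have hTW : ∀ X ∈ W, T X ∈ W := by
    rintro _ ⟨U, hU, rfl⟩
    exact ⟨T U, hTE U hU, rfl⟩
  have hW : Nontrivial W := by
    refine Submodule.nontrivial_iff_ne_bot.2 fun hbot => hne ?_
    have : T 1 ∈ W := ⟨1, (hE 1).2 (by simp), rfl⟩
    rw [hbot, Submodule.mem_bot, hT, mul_one, one_mul] at this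
    exact sub_eq_zero.1 this
  obtain ⟨z, hz⟩ := Module.End.exists_eigenvalue (T.restrict hTW)
  obtain ⟨w, hw⟩ := hz.exists_hasEigenvector
  obtain ⟨U, hU, hUw⟩ := w.2
  have hw0 : (w : Matrix n n ℂ) ≠ 0 := fun h0 => hw.2 (Subtype.ext h0)
  have hTw : T w = z • (w : Matrix n n ℂ) := congrArg Subtype.val hw.apply_eq_smul
  have hwE : (w : Matrix n n ℂ) ∈ E := hUw ▸ hTE U hU
  rw [hE] at hwE
  have hUE := (hE U).1 hU
  have hint : L₁ * (w : Matrix n n ℂ) = w * (L₂ + algebraMap ℂ _ z) := by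
    rw [mul_add, Algebra.algebraMap_eq_smul_one, mul_smul_comm, mul_one, ← hTw, hT]
    abel
  -- `z` is a difference of an eigenvalue of `L₁` and one of `L₂`, so its imaginary part is below
  -- `2π` in absolute value. Exponentiating the intertwining relation, with `w` commuting with `M`,
  -- gives `exp z = 1`.
  have hz0 : z = 0 := by
    obtain ⟨a, ha, ha'⟩ := exists_common_eigenvalue hint hw0
    have hb : a - z ∈ spectrum ℂ L₂ := by
      rwa [← sub_add_cancel a z, add_comm L₂, spectrum.add_mem_add_iff] at ha'
    have hexp := matrix_exp_mul_eq_mul_exp hint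
    rw [matrix_exp_add_algebraMap, h₁.1, h₂.1, hwE, mul_smul_comm] at hexp
    have hez : Complex.exp z = 1 := by
      have h3 : (1 - Complex.exp z) • ((w : Matrix n n ℂ) * M) = 0 := by
        rw [sub_smul, one_smul, ← hexp, sub_self]
      rcases smul_eq_zero.1 h3 with h | h
      · exact (sub_eq_zero.1 h).symm
      · exact absurd (hM.mul_left_eq_zero.1 h) hw0
    have i1 := h₁.2 a ha
    have i2 := h₂.2 _ hb
    rw [Complex.sub_im] at i2
    rw [Complex.exp_eq_one_iff] at hez
    obtain ⟨k, hk⟩ := hez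
    have him : z.im = k * (2 * Real.pi) := by rw [hk]; simp
    have hpi := Real.pi_pos
    have hk0 : k = 0 := by
      have hk1 : (k : ℝ) < 1 := by nlinarith
      have hk2 : (-1 : ℝ) < k := by nlinarith
      have hk1' : k < 1 := by exact_mod_cast hk1
      have hk2' : -1 < k := by exact_mod_cast hk2
      omega
    rw [hk, hk0]; simp
  subst hz0
  rw [zero_smul, hT, sub_eq_zero] at hTw
  -- This reads `M U = (U + w) M`; as `U` commutes with `M`, it leaves `w M = 0` with `M`
  -- invertible.
  have h6 := matrix_exp_mul_of_sub_intertwines (hT U ▸ hUw) hTw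
  rw [h₁.1, h₂.1, hUE, add_mul, left_eq_add] at h6
  exact hw0 (hM.mul_left_eq_zero.1 h6)

end Log
end FreqLim

namespace FreqLim

/-! ### Entrywise integrals over the band. -/

section BandIntegral

variable {a b c : Type*} {ω : ℝ} {F K : ℝ → Matrix a b ℂ}

theorem bandIntegral_apply (ω : ℝ) (F : ℝ → Matrix a b ℂ) (i : a) (j : b) :
    bandIntegral ω F i j = ∫ ν in (-ω)..ω, F ν i j := rfl

theorem intervalIntegrable_entry (hF : Continuous F) (i : a) (j : b) (s t : ℝ) :
    IntervalIntegrable (fun ν => F ν i j) MeasureTheory.volume s t :=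
  (hF.matrix_elem i j).intervalIntegrable s t

theorem bandIntegral_add (hF : Continuous F) (hK : Continuous K) :
    bandIntegral ω (fun ν => F ν + K ν) = bandIntegral ω F + bandIntegral ω K := by
  ext i j
  exact intervalIntegral.integral_add (intervalIntegrable_entry hF i j _ _)
    (intervalIntegrable_entry hK i j _ _)

theorem bandIntegral_const (M : Matrix a b ℂ) :
    bandIntegral ω (fun _ => M) = (2 * (ω : ℂ)) • M := by
  ext i j
  rw [bandIntegral_apply, intervalIntegral.integral_const, Matrix.smul_apply, smul_eq_mul,
    Complex.real_smul]
  push_cast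
  ring

theorem bandIntegral_mul_left [Fintype a] (M : Matrix c a ℂ) (hF : Continuous F) :
    bandIntegral ω (fun ν => M * F ν) = M * bandIntegral ω F := by
  ext i j
  simp only [bandIntegral_apply, Matrix.mul_apply]
  rw [intervalIntegral.integral_finsetSum
    fun k _ => (intervalIntegrable_entry hF k j _ _).const_mul _]
  simp only [intervalIntegral.integral_const_mul]

theorem bandIntegral_mul_right [Fintype b] (M : Matrix b c ℂ) (hF : Continuous F) :
    bandIntegral ω (fun ν => F ν * M) = bandIntegral ω F * M := by
  ext i j
  simp only [bandIntegral_apply, Matrix.mul_apply]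
  rw [intervalIntegral.integral_finsetSum
    fun k _ => (intervalIntegrable_entry hF i k _ _).mul_const _]
  simp only [intervalIntegral.integral_mul_const]

theorem bandIntegral_mulVec [Fintype b] (v : b → ℂ) (hF : Continuous F) (i : a) :
    (bandIntegral ω F *ᵥ v) i = ∫ ν in (-ω)..ω, (F ν *ᵥ v) i := by
  simp only [Matrix.mulVec, dotProduct, bandIntegral_apply]
  rw [intervalIntegral.integral_finsetSum
    fun k _ => (intervalIntegrable_entry hF i k _ _).mul_const _]
  simp only [intervalIntegral.integral_mul_const]

theorem bandIntegral_trace [Fintype a] {F : ℝ → Matrix a a ℂ} (hF : Continuous F) :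
    (bandIntegral ω F).trace = ∫ ν in (-ω)..ω, (F ν).trace := by
  simp only [Matrix.trace, Matrix.diag, bandIntegral_apply]
  rw [intervalIntegral.integral_finsetSum fun k _ => intervalIntegrable_entry hF k k _ _]

theorem bandIntegral_transpose : bandIntegral ω (fun ν => (F ν)ᵀ) = (bandIntegral ω F)ᵀ := rfl

theorem bandIntegral_map_star :
    bandIntegral ω (fun ν => (F ν).map star) = (bandIntegral ω F).map star := by
  ext i j
  simp only [bandIntegral_apply, Matrix.map_apply, intervalIntegral, star_sub]
  congr 1 <;> exact integral_conj

theorem bandIntegral_conjTranspose :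
    bandIntegral ω (fun ν => (F ν)ᴴ) = (bandIntegral ω F)ᴴ := by
  change bandIntegral ω (fun ν => ((F ν)ᵀ).map star) = ((bandIntegral ω F)ᵀ).map star
  rw [bandIntegral_map_star, bandIntegral_transpose]

theorem bandIntegral_comp_neg : bandIntegral ω (fun ν => F (-ν)) = bandIntegral ω F := by
  ext i j
  simp only [bandIntegral_apply]
  rw [intervalIntegral.integral_comp_neg (fun ν => F ν i j), neg_neg]

theorem commute_bandIntegral [Fintype a] {F : ℝ → Matrix a a ℂ} {M : Matrix a a ℂ}
    (hF : Continuous F) (h : ∀ ν, Commute M (F ν)) : Commute M (bandIntegral ω F) := by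
  rw [commute_iff_eq, ← bandIntegral_mul_left M hF, ← bandIntegral_mul_right M hF]
  simp only [(h _).eq]

/-- Both endpoints move with `w`; splitting the integral at `0` gives one boundary term from each.
-/
theorem hasDerivAt_bandIntegral_entry (hF : Continuous F) (i : a) (j : b) (t : ℝ) :
    HasDerivAt (fun w => bandIntegral w F i j) ((F t + F (-t)) i j) t := by
  have hc := hF.matrix_elem i j
  have h1 := intervalIntegral.integral_hasDerivAt_right (hc.intervalIntegrable 0 t)
    hc.aestronglyMeasurable.stronglyMeasurableAtFilter hc.continuousAt
  have h2 := intervalIntegral.integral_hasDerivAt_right (hc.intervalIntegrable 0 (-t))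
    hc.aestronglyMeasurable.stronglyMeasurableAtFilter hc.continuousAt
  have h3 := h1.sub (h2.scomp t (hasDerivAt_neg t))
  refine (h3.congr_deriv (by simp)).congr_of_eventuallyEq (Filter.Eventually.of_forall fun w => ?_)
  simp only [bandIntegral_apply, Pi.sub_apply, Function.comp]
  rw [intervalIntegral.integral_interval_sub_left] <;> exact hc.intervalIntegrable _ _

end BandIntegral

/-! ### The resolvent on the imaginary axis and the logarithm as its integral. -/

section Resolvent

variable {n : Type*} [Fintype n] [DecidableEq n] {A : Matrix n n ℝ}

theorem IsHurwitz.isUnit_sub (hA : IsHurwitz A) (ν : ℝ) :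
    IsUnit ((Complex.I * (ν : ℂ)) • (1 : Matrix n n ℂ) - toC A) := by
  by_contra h
  have := hA (Complex.I * ν) (by
    rwa [spectrum.mem_iff, Algebra.algebraMap_eq_smul_one])
  simp at this

theorem IsHurwitz.mul_resolventH (hA : IsHurwitz A) (ν : ℝ) :
    toC A * resolventH A ν = (Complex.I * (ν : ℂ)) • resolventH A ν - 1 := by
  have h := Matrix.mul_nonsing_inv _ ((Matrix.isUnit_iff_isUnit_det _).1 (hA.isUnit_sub ν))
  rw [Matrix.sub_mul, Matrix.smul_mul, Matrix.one_mul] at h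
  exact eq_sub_of_add_eq (sub_eq_iff_eq_add'.1 h).symm

theorem IsHurwitz.resolventH_mul (hA : IsHurwitz A) (ν : ℝ) :
    resolventH A ν * toC A = (Complex.I * (ν : ℂ)) • resolventH A ν - 1 := by
  have h := Matrix.nonsing_inv_mul _ ((Matrix.isUnit_iff_isUnit_det _).1 (hA.isUnit_sub ν))
  rw [Matrix.mul_sub, Matrix.mul_smul, Matrix.mul_one] at h
  exact eq_sub_of_add_eq (sub_eq_iff_eq_add'.1 h).symm

theorem IsHurwitz.continuous_resolventH (hA : IsHurwitz A) : Continuous (resolventH A) := by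
  have hc : Continuous fun ν : ℝ => (Complex.I * (ν : ℂ)) • (1 : Matrix n n ℂ) - toC A := by
    fun_prop
  have h : resolventH A = fun ν : ℝ =>
      ((Complex.I * (ν : ℂ)) • (1 : Matrix n n ℂ) - toC A).det⁻¹ •
        ((Complex.I * (ν : ℂ)) • (1 : Matrix n n ℂ) - toC A).adjugate := by
    funext ν
    rw [resolventH, Matrix.inv_def, Ring.inverse_eq_inv]
  rw [h]
  exact (hc.matrix_det.inv₀ fun ν => ((Matrix.isUnit_iff_isUnit_det _).1
    (hA.isUnit_sub ν)).ne_zero).smul hc.matrix_adjugate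

theorem IsHurwitz.commute_resolventH (hA : IsHurwitz A) (ν : ℝ) :
    Commute (toC A) (resolventH A ν) :=
  (hA.mul_resolventH ν).trans (hA.resolventH_mul ν).symm

/-- The resolvent identity. -/
theorem IsHurwitz.resolventH_sub (hA : IsHurwitz A) (s t : ℝ) :
    resolventH A s - resolventH A t
      = (-(Complex.I * ((s - t : ℝ) : ℂ))) • (resolventH A s * resolventH A t) := by
  -- Evaluate `H(s) A H(t)` in two ways, absorbing `A` to the right or to the left.
  have h1 := congrArg (resolventH A s * ·) (hA.mul_resolventH t)
  have h2 := congrArg (· * resolventH A t) (hA.resolventH_mul s)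
  simp only [Matrix.mul_sub, Matrix.sub_mul, Matrix.mul_smul, Matrix.smul_mul, Matrix.mul_one,
    Matrix.one_mul] at h1 h2
  rw [← Matrix.mul_assoc, h2] at h1
  have h3 := sub_eq_sub_iff_sub_eq_sub.1 h1
  push_cast
  rw [mul_sub, neg_sub, sub_smul, ← neg_sub (resolventH A t), ← h3]
  abel

theorem IsHurwitz.commute_resolventH_resolventH (hA : IsHurwitz A) (s t : ℝ) :
    Commute (resolventH A s) (resolventH A t) := by
  rcases eq_or_ne s t with rfl | h
  · exact Commute.refl _
  have h1 := hA.resolventH_sub s t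
  have h2 := hA.resolventH_sub t s
  rw [← neg_sub, h1, ← neg_smul] at h2
  have hc : Complex.I * ((t - s : ℝ) : ℂ) ≠ 0 :=
    mul_ne_zero Complex.I_ne_zero (by exact_mod_cast sub_ne_zero.2 h.symm)
  have h3 : (-(Complex.I * ((t - s : ℝ) : ℂ))) • (resolventH A s * resolventH A t)
      = (-(Complex.I * ((t - s : ℝ) : ℂ))) • (resolventH A t * resolventH A s) := by
    rw [← h2]
    congr 1
    push_cast
    ring
  exact smul_right_injective _ (neg_ne_zero.2 hc) h3

theorem IsHurwitz.resolventH_mulVec (hA : IsHurwitz A) (ν : ℝ) {v : n → ℂ} {l : ℂ}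
    (hl : l.re < 0) (hv : toC A *ᵥ v = l • v) :
    resolventH A ν *ᵥ v = (Complex.I * (ν : ℂ) - l)⁻¹ • v := by
  have hne : Complex.I * (ν : ℂ) - l ≠ 0 := by
    intro h
    have := congrArg Complex.re h
    simp at this
    exact hl.ne this
  have h1 := congrArg (· *ᵥ v) (hA.resolventH_mul ν)
  simp only [← Matrix.mulVec_mulVec, hv, Matrix.mulVec_smul, Matrix.sub_mulVec, Matrix.smul_mulVec,
    Matrix.one_mulVec] at h1
  rw [eq_inv_smul_iff₀ hne, sub_smul, h1]
  abel

/-- The integral of the resolvent of `A` over the band, rotated by `-i`. -/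
noncomputable def logIntegral (A : Matrix n n ℝ) (ω : ℝ) : Matrix n n ℂ :=
  (-Complex.I) • bandIntegral ω (resolventH A)

theorem IsHurwitz.commute_logIntegral (hA : IsHurwitz A) (s t : ℝ) :
    Commute (logIntegral A s) (logIntegral A t) :=
  ((commute_bandIntegral hA.continuous_resolventH fun ν =>
    (commute_bandIntegral hA.continuous_resolventH fun μ =>
      hA.commute_resolventH_resolventH ν μ).symm).smul_left _).smul_right _

/-- The real part of `(iν - l)⁻¹` is `-Re l / ((Re l)² + (ν - Im l)²)`, the derivative of an
arctangent. -/
theorem integral_re_inv (ω : ℝ) {l : ℂ} (hl : l.re < 0) :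
    (∫ ν in (-ω)..ω, (Complex.I * (ν : ℂ) - l)⁻¹).re
      = Real.arctan ((ω - l.im) / -l.re) - Real.arctan ((-ω - l.im) / -l.re) := by
  have hne : ∀ ν : ℝ, Complex.I * (ν : ℂ) - l ≠ 0 := by
    intro ν h
    have := congrArg Complex.re h
    simp at this
    exact hl.ne this
  have hc : Continuous fun ν : ℝ => (Complex.I * (ν : ℂ) - l)⁻¹ :=
    Continuous.inv₀ (by fun_prop) hne
  have h1 := Complex.reCLM.intervalIntegral_comp_comm (hc.intervalIntegrable
    (μ := MeasureTheory.volume) (-ω) ω)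
  rw [Complex.reCLM_apply] at h1
  rw [← h1]
  refine intervalIntegral.integral_eq_sub_of_hasDerivAt
    (f := fun ν : ℝ => Real.arctan ((ν - l.im) / -l.re)) (fun ν _ => ?_)
    ((Complex.continuous_re.comp hc).intervalIntegrable _ _)
  have h2 := (((hasDerivAt_id ν).sub_const l.im).div_const (-l.re)).arctan
  refine h2.congr_deriv ?_
  have hq : ∀ u : ℝ, 1 / (1 + (u / -l.re) ^ 2) * (1 / -l.re) = -l.re / (l.re * l.re + u * u) := by
    intro u
    have hl' := hl.ne
    have : l.re * l.re + u * u ≠ 0 := by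
      nlinarith [mul_self_nonneg u, mul_pos_of_neg_of_neg hl hl]
    have : l.re ^ 2 + u ^ 2 ≠ 0 := by rwa [sq, sq]
    field_simp
  rw [id, hq]
  simp [Complex.normSq_apply]

/-- A common eigenvector with `A` turns `z` into `-i ∫ (iν - l)⁻¹ dν`. So `Im z` is minus the real
part of that integral, a difference of two arctangents, each strictly within `π/2` of zero. -/
theorem IsHurwitz.spectrum_logIntegral (hA : IsHurwitz A) (ω : ℝ) :
    ∀ z ∈ spectrum ℂ (logIntegral A ω), -Real.pi < z.im ∧ z.im < Real.pi := by
  intro z hz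
  have hcomm : Commute (logIntegral A ω) (toC A) :=
    ((commute_bandIntegral hA.continuous_resolventH hA.commute_resolventH).smul_right _).symm
  obtain ⟨v, hv0, hLv, l, hl, hAv⟩ := exists_common_eigenvector hcomm hz
  have hl' := hA l hl
  obtain ⟨i, hi⟩ := Function.ne_iff.1 hv0
  have h1 := congrFun hLv i
  rw [logIntegral, Matrix.smul_mulVec, Pi.smul_apply,
    bandIntegral_mulVec v hA.continuous_resolventH] at h1
  simp only [hA.resolventH_mulVec _ hl' hAv, Pi.smul_apply, smul_eq_mul,
    intervalIntegral.integral_mul_const] at h1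
  rw [← mul_assoc] at h1
  have h2 := mul_right_cancel₀ hi h1
  have h3 : z.im = -(∫ ν in (-ω)..ω, (Complex.I * (ν : ℂ) - l)⁻¹).re := by
    rw [← h2]; simp
  rw [h3, integral_re_inv ω hl']
  have a1 := Real.arctan_lt_pi_div_two ((ω - l.im) / -l.re)
  have a2 := Real.neg_pi_div_two_lt_arctan ((ω - l.im) / -l.re)
  have a3 := Real.arctan_lt_pi_div_two ((-ω - l.im) / -l.re)
  have a4 := Real.neg_pi_div_two_lt_arctan ((-ω - l.im) / -l.re)
  constructor <;> linarith

omit [DecidableEq n] in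
open scoped Matrix.Norms.Operator in
theorem hasDerivAt_of_entries {F : ℝ → Matrix n n ℂ} {F' : Matrix n n ℂ} {t : ℝ}
    (h : ∀ i j, HasDerivAt (fun s => F s i j) (F' i j) t) : HasDerivAt F F' t :=
  hasDerivAt_pi.2 fun i => hasDerivAt_pi.2 fun j => h i j

open scoped Matrix.Norms.Operator in
theorem IsHurwitz.hasDerivAt_resolventH (hA : IsHurwitz A) (t : ℝ) :
    HasDerivAt (resolventH A) (-Complex.I • (resolventH A t * resolventH A t)) t := by
  refine hasDerivAt_iff_tendsto_slope.2 ?_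
  have hc : Continuous fun s => -Complex.I • (resolventH A s * resolventH A t) := by
    have : Continuous (resolventH A) := hA.continuous_resolventH
    fun_prop
  refine ((hc.tendsto t).mono_left nhdsWithin_le_nhds).congr' ?_
  filter_upwards [self_mem_nhdsWithin] with s hs
  have hst : ((s - t : ℝ) : ℂ) ≠ 0 := by exact_mod_cast sub_ne_zero.2 hs
  rw [slope_def_module, hA.resolventH_sub, ← Complex.coe_smul, smul_smul, Complex.ofReal_inv]
  congr 1
  field_simp

open scoped Matrix.Norms.Operator in
theorem IsHurwitz.exp_neg_logIntegral_mul (hA : IsHurwitz A) (ω : ℝ) :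
    NormedSpace.exp (-logIntegral A ω) *
      ((toC A + (Complex.I * (ω : ℂ)) • (1 : Matrix n n ℂ)) * resolventH A ω) = -1 := by
  have hL : ∀ t, HasDerivAt (fun w => -logIntegral A w)
      (Complex.I • (resolventH A t + resolventH A (-t))) t := by
    intro t
    refine hasDerivAt_of_entries fun i j => ?_
    have := (hasDerivAt_bandIntegral_entry hA.continuous_resolventH i j t).const_mul Complex.I
    simpa [logIntegral] using this
  have hM : ∀ t : ℝ, HasDerivAt (fun w : ℝ => toC A + (Complex.I * (w : ℂ)) • (1 : Matrix n n ℂ))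
      (Complex.I • 1) t := by
    intro t
    have := (((Complex.ofRealCLM.hasDerivAt (x := t)).const_mul Complex.I).smul_const
      (1 : Matrix n n ℂ)).const_add (toC A)
    exact this.congr_deriv (by simp)
  have hd : ∀ t, HasDerivAt (fun w : ℝ => NormedSpace.exp (-logIntegral A w) *
      ((toC A + (Complex.I * (w : ℂ)) • (1 : Matrix n n ℂ)) * resolventH A w)) 0 t := by
    intro t
    have h1 := (hasDerivAt_exp_of_commute (hL t) fun s =>
      (hA.commute_logIntegral s t).neg_left.neg_right).mul ((hM t).mul (hA.hasDerivAt_resolventH t))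
    refine h1.congr_deriv ?_
    -- `H(-t)` is the inverse of `-(A + itI)`, so the contribution of the lower endpoint collapses
    -- to `-i H(t)`, cancelling the derivative of the factor `A + iwI`.
    have h2 : resolventH A (-t) * (toC A + (Complex.I * (t : ℂ)) • 1) = -1 := by
      rw [Matrix.mul_add, hA.resolventH_mul]
      simp
      abel
    have h3 : (resolventH A t) * (toC A + (Complex.I * (t : ℂ)) • 1) =
        (toC A + (Complex.I * (t : ℂ)) • 1) * resolventH A t := by
      rw [Matrix.mul_add, Matrix.add_mul, (hA.commute_resolventH t).eq]
      simp
    have h4 : Complex.I • (resolventH A t + resolventH A (-t)) *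
        ((toC A + (Complex.I * (t : ℂ)) • 1) * resolventH A t) =
        Complex.I • ((toC A + (Complex.I * (t : ℂ)) • 1) * (resolventH A t * resolventH A t))
          - Complex.I • resolventH A t := by
      rw [smul_mul_assoc, add_mul, ← mul_assoc, ← mul_assoc, h2, h3, neg_one_mul, mul_assoc,
        smul_add, smul_neg, sub_eq_add_neg]
    simp only [Pi.mul_apply]
    rw [mul_assoc, h4, ← mul_add]
    convert mul_zero _
    simp
    abel
  have h0 := is_const_of_deriv_eq_zero (fun t => (hd t).differentiableAt)
    (fun t => (hd t).deriv) ω 0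
  refine h0.trans ?_
  -- At `ω = 0` the band is empty and `A H(0) = -I`, which fixes the constant.
  have hz : logIntegral A 0 = 0 := by
    ext i j
    simp [logIntegral, bandIntegral_apply]
  rw [hz]
  simp [hA.mul_resolventH]

theorem IsHurwitz.exp_logIntegral (hA : IsHurwitz A) (ω : ℝ) :
    NormedSpace.exp (logIntegral A ω) = cayley ω A := by
  have h : NormedSpace.exp (-logIntegral A ω) * cayley ω A = 1 := by
    have h1 : NormedSpace.exp (-logIntegral A ω) *
      ((toC A + (Complex.I * (ω : ℂ)) • (1 : Matrix n n ℂ)) * resolventH A ω) = -1 :=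
      hA.exp_neg_logIntegral_mul ω
    have h2 : (toC A - (Complex.I * (ω : ℂ)) • (1 : Matrix n n ℂ))⁻¹ = -resolventH A ω := by
      refine Matrix.inv_eq_right_inv ?_
      rw [Matrix.mul_neg, Matrix.sub_mul, hA.mul_resolventH]
      simp
    rw [cayley, h2, Matrix.mul_neg, Matrix.mul_neg, h1, neg_neg]
  rw [Matrix.exp_neg] at h
  have hu : IsUnit (NormedSpace.exp (logIntegral A ω)) := Matrix.isUnit_exp (logIntegral A ω)
  rw [← Matrix.inv_eq_right_inv h, Matrix.nonsing_inv_nonsing_inv _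
    ((Matrix.isUnit_iff_isUnit_det _).1 hu)]

theorem IsHurwitz.isPrincipalLog (hA : IsHurwitz A) (ω : ℝ) :
    IsPrincipalLog (cayley ω A) (logIntegral A ω) :=
  ⟨hA.exp_logIntegral ω, hA.spectrum_logIntegral ω⟩

theorem IsHurwitz.existsUnique_isPrincipalLog (hA : IsHurwitz A) (ω : ℝ) :
    ∃! L, IsPrincipalLog (cayley ω A) L :=
  ⟨_, hA.isPrincipalLog ω, fun _ h => h.unique (hA.isPrincipalLog ω)⟩

/-- The factor is `i · (-i) = 1`. Uniqueness is what identifies the logarithm selected by choice in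
`matrixLog` with the integral. -/
theorem IsHurwitz.logS_eq (hA : IsHurwitz A) (ω : ℝ) :
    logS ω A = (1 / (2 * (Real.pi : ℂ))) • bandIntegral ω (resolventH A) := by
  have h : ∃ L, IsPrincipalLog (cayley ω A) L := ⟨_, hA.isPrincipalLog ω⟩
  have h1 : matrixLog (cayley ω A) = logIntegral A ω := by
    rw [matrixLog, dif_pos h]
    exact h.choose_spec.unique (hA.isPrincipalLog ω)
  rw [logS, h1, logIntegral, smul_smul]
  congr 1
  rw [div_mul_eq_mul_div, mul_neg, Complex.I_mul_I, neg_neg]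

end Resolvent

end FreqLim

namespace FreqLim

/-! ### Real matrices viewed as complex ones. -/

section Real

variable {a b c d : Type*}

theorem toC_transpose (M : Matrix a b ℝ) : toC Mᵀ = (toC M)ᵀ := rfl

theorem toC_map_star (M : Matrix a b ℝ) : (toC M).map star = toC M := by
  ext i j
  simp [toC]

theorem toC_conjTranspose (M : Matrix a b ℝ) : (toC M)ᴴ = (toC M)ᵀ :=
  congrArg Matrix.transpose (toC_map_star M)

theorem toC_sub (M N : Matrix a b ℝ) : toC (M - N) = toC M - toC N := by
  ext i j
  simp [toC]

theorem toC_neg (M : Matrix a b ℝ) : toC (-M) = -toC M := by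
  ext i j
  simp [toC]

theorem toC_mul [Fintype b] (M : Matrix a b ℝ) (N : Matrix b c ℝ) :
    toC (M * N) = toC M * toC N :=
  Matrix.map_mul (f := Complex.ofRealHom)

theorem toC_fromBlocks (M : Matrix a c ℝ) (N : Matrix b d ℝ) :
    toC (Matrix.fromBlocks M 0 0 N) = Matrix.fromBlocks (toC M) 0 0 (toC N) := by
  ext (i | i) (j | j) <;> simp [toC]

theorem toC_fromRows (M : Matrix a c ℝ) (N : Matrix b c ℝ) :
    toC (Matrix.fromRows M N) = Matrix.fromRows (toC M) (toC N) := by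
  ext (i | i) j <;> simp [toC]

theorem toC_fromCols_neg (M : Matrix a c ℝ) (N : Matrix a d ℝ) :
    toC (Matrix.fromCols M (-N)) = Matrix.fromCols (toC M) (-toC N) := by
  ext i (j | j) <;> simp [toC]

theorem map_star_mul [Fintype b] (M : Matrix a b ℂ) (N : Matrix b c ℂ) :
    (M * N).map star = M.map star * N.map star :=
  Matrix.map_mul (f := starRingEnd ℂ)

theorem bandIntegral_fromBlocks (ω : ℝ) (F : ℝ → Matrix a c ℂ) (K : ℝ → Matrix a d ℂ)
    (L : ℝ → Matrix b c ℂ) (M : ℝ → Matrix b d ℂ) :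
    bandIntegral ω (fun ν => Matrix.fromBlocks (F ν) (K ν) (L ν) (M ν)) =
      Matrix.fromBlocks (bandIntegral ω F) (bandIntegral ω K) (bandIntegral ω L)
        (bandIntegral ω M) := by
  ext (i | i) (j | j) <;> rfl

end Real

/-! ### Sylvester equations for band integrals, and consequences of realness. -/

section Equations

variable {n r : Type*} [Fintype n] [DecidableEq n] [Fintype r] [DecidableEq r]
  {A : Matrix n n ℝ} {A' : Matrix r r ℝ}

theorem IsHurwitz.transpose (hA : IsHurwitz A) : IsHurwitz Aᵀ := by
  intro z hz
  refine hA z ?_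
  rw [Matrix.mem_spectrum_iff_isRoot_charpoly] at hz ⊢
  rwa [toC_transpose, Matrix.charpoly_transpose] at hz

theorem IsHurwitz.fromBlocks (hA : IsHurwitz A) (hA' : IsHurwitz A') :
    IsHurwitz (Matrix.fromBlocks A 0 0 A') := by
  intro z hz
  rw [Matrix.mem_spectrum_iff_isRoot_charpoly, toC_fromBlocks,
    Matrix.charpoly_fromBlocks_zero₁₂, Polynomial.root_mul] at hz
  rcases hz with h | h
  · exact hA z (Matrix.mem_spectrum_iff_isRoot_charpoly.2 h)
  · exact hA' z (Matrix.mem_spectrum_iff_isRoot_charpoly.2 h)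

theorem sylvester_unique {A₁ : Matrix n n ℂ} {A₂ : Matrix r r ℂ} {W X : Matrix n r ℂ}
    (h₁ : ∀ z ∈ spectrum ℂ A₁, z.re < 0) (h₂ : ∀ z ∈ spectrum ℂ A₂, z.re < 0)
    (hX : A₁ * X + X * A₂ + W = 0) (Z : Matrix n r ℂ) :
    A₁ * Z + Z * A₂ + W = 0 ↔ Z = X := by
  refine ⟨fun hZ => ?_, fun h => h ▸ hX⟩
  refine sub_eq_zero.1 (sylvester_eq_zero h₁ h₂ ?_)
  rw [Matrix.mul_sub, Matrix.sub_mul, ← sub_self (0 : Matrix n r ℂ)]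
  nth_rewrite 1 [← hZ]
  rw [← hX]
  abel

/-- The scalars `c ν` and `-c ν` from the two sides cancel under the integral. Taking `c ν = iν`
gives the controllability equations, `c ν = -iν` the observability ones. -/
theorem bandIntegral_sylvester {ω : ℝ} {F : ℝ → Matrix n n ℂ} {K : ℝ → Matrix r r ℂ}
    {A₁ : Matrix n n ℂ} {A₂ : Matrix r r ℂ} (c : ℝ → ℂ) (hF : Continuous F) (hK : Continuous K)
    (h₁ : ∀ ν, A₁ * F ν = c ν • F ν - 1) (h₂ : ∀ ν, K ν * A₂ = -c ν • K ν - 1)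
    (M : Matrix n r ℂ) :
    A₁ * bandIntegral ω (fun ν => F ν * M * K ν) + bandIntegral ω (fun ν => F ν * M * K ν) * A₂
      + (bandIntegral ω F * M + M * bandIntegral ω K) = 0 := by
  have hFM : Continuous fun ν => F ν * M := hF.matrix_mul continuous_const
  have hMK : Continuous fun ν => M * K ν := continuous_const.matrix_mul hK
  have hFMK : Continuous fun ν => F ν * M * K ν := hFM.matrix_mul hK
  rw [← bandIntegral_mul_left _ hFMK, ← bandIntegral_mul_right _ hFMK,
    ← bandIntegral_mul_left _ hK, ← bandIntegral_mul_right _ hF,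
    ← bandIntegral_add (continuous_const.matrix_mul hFMK) (hFMK.matrix_mul continuous_const),
    ← bandIntegral_add hFM hMK, ← bandIntegral_add
      ((continuous_const.matrix_mul hFMK).fun_add (hFMK.matrix_mul continuous_const)) (hFM.fun_add hMK)]
  have : ∀ ν, A₁ * (F ν * M * K ν) + F ν * M * K ν * A₂ + (F ν * M + M * K ν) = 0 := by
    intro ν
    rw [Matrix.mul_assoc _ (K ν), h₂, ← Matrix.mul_assoc, ← Matrix.mul_assoc, h₁]
    simp only [Matrix.sub_mul, Matrix.mul_sub, Matrix.smul_mul, Matrix.mul_smul, Matrix.one_mul,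
      Matrix.mul_one, neg_smul, Matrix.mul_neg]
    abel
  simp only [this]
  rw [bandIntegral_const, smul_zero]

theorem IsHurwitz.transpose_mul_conjTranspose_resolventH (hA : IsHurwitz A) (ν : ℝ) :
    (toC A)ᵀ * (resolventH A ν)ᴴ = (-(Complex.I * (ν : ℂ))) • (resolventH A ν)ᴴ - 1 := by
  have := congrArg Matrix.conjTranspose (hA.resolventH_mul ν)
  simpa [toC_conjTranspose] using this

theorem IsHurwitz.conjTranspose_resolventH_mul_transpose (hA : IsHurwitz A) (ν : ℝ) :
    (resolventH A ν)ᴴ * (toC A)ᵀ = (-(Complex.I * (ν : ℂ))) • (resolventH A ν)ᴴ - 1 := by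
  have := congrArg Matrix.conjTranspose (hA.mul_resolventH ν)
  simpa [toC_conjTranspose] using this

theorem IsHurwitz.continuous_conjTranspose_resolventH (hA : IsHurwitz A) :
    Continuous fun ν => (resolventH A ν)ᴴ :=
  hA.continuous_resolventH.matrix_conjTranspose

theorem IsHurwitz.logS_conjTranspose (hA : IsHurwitz A) (ω : ℝ) :
    (logS ω A)ᴴ = (1 / (2 * (Real.pi : ℂ))) • bandIntegral ω (fun ν => (resolventH A ν)ᴴ) := by
  rw [hA.logS_eq, Matrix.conjTranspose_smul, bandIntegral_conjTranspose]
  simp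

theorem ctrl_sylvester_iff (hA : IsHurwitz A) (hA' : IsHurwitz A') (ω : ℝ) (M Z : Matrix n r ℂ) :
    toC A * Z + Z * (toC A')ᵀ + (logS ω A * M + M * (logS ω A')ᴴ) = 0 ↔
      Z = (1 / (2 * (Real.pi : ℂ))) •
        bandIntegral ω (fun ν => resolventH A ν * M * (resolventH A' ν)ᴴ) := by
  refine sylvester_unique hA hA'.transpose ?_ Z
  rw [toC_transpose, hA.logS_eq, hA'.logS_conjTranspose, Matrix.mul_smul, Matrix.smul_mul, Matrix.smul_mul,
    Matrix.mul_smul, ← smul_add, ← smul_add, ← smul_add,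
    bandIntegral_sylvester (fun ν => Complex.I * (ν : ℂ)) hA.continuous_resolventH
      hA'.continuous_conjTranspose_resolventH hA.mul_resolventH
      hA'.conjTranspose_resolventH_mul_transpose, smul_zero]

theorem obs_sylvester_iff (hA : IsHurwitz A) (hA' : IsHurwitz A') (ω : ℝ) (M Z : Matrix n r ℂ) :
    (toC A)ᵀ * Z + Z * toC A' + ((logS ω A)ᴴ * M + M * logS ω A') = 0 ↔
      Z = (1 / (2 * (Real.pi : ℂ))) •
        bandIntegral ω (fun ν => (resolventH A ν)ᴴ * M * resolventH A' ν) := by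
  refine sylvester_unique hA.transpose hA' ?_ Z
  rw [toC_transpose, hA'.logS_eq, hA.logS_conjTranspose, Matrix.mul_smul, Matrix.smul_mul, Matrix.smul_mul,
    Matrix.mul_smul, ← smul_add, ← smul_add, ← smul_add,
    bandIntegral_sylvester (fun ν => -(Complex.I * (ν : ℂ)))
      hA.continuous_conjTranspose_resolventH hA'.continuous_resolventH
      hA.transpose_mul_conjTranspose_resolventH
      (fun ν => by rw [neg_neg]; exact hA'.resolventH_mul ν), smul_zero]

theorem IsHurwitz.resolventH_map_star (hA : IsHurwitz A) (ν : ℝ) :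
    (resolventH A ν).map star = resolventH A (-ν) := by
  symm
  refine Matrix.inv_eq_right_inv ?_
  have h := Matrix.mul_nonsing_inv _ ((Matrix.isUnit_iff_isUnit_det _).1 (hA.isUnit_sub ν))
  have h1 := congrArg (fun M : Matrix n n ℂ => M.map star) h
  simp only [map_star_mul] at h1
  have h2 : ((Complex.I * (ν : ℂ)) • (1 : Matrix n n ℂ) - toC A).map star
      = (Complex.I * ((-ν : ℝ) : ℂ)) • (1 : Matrix n n ℂ) - toC A := by
    ext i j
    rcases eq_or_ne i j with rfl | hij
    · simp [toC]
    · simp [toC, hij]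
  have h3 : (1 : Matrix n n ℂ).map star = 1 := Matrix.map_one _ (star_zero ℂ) (star_one ℂ)
  rwa [h2, h3] at h1

theorem IsHurwitz.resolventH_conjTranspose_map_star (hA : IsHurwitz A) (ν : ℝ) :
    ((resolventH A ν)ᴴ).map star = (resolventH A (-ν))ᴴ := by
  rw [← hA.resolventH_map_star]
  rfl

/-- `S_ω` is real: conjugation sends `H(ν)` to `H(-ν)`, and the band is symmetric. -/
theorem IsHurwitz.logS_conjTranspose_eq_transpose (hA : IsHurwitz A) (ω : ℝ) :
    (logS ω A)ᴴ = (logS ω A)ᵀ := by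
  have h : (fun ν => (resolventH A ν)ᴴ) = fun ν => (resolventH A (-ν))ᵀ := by
    funext ν
    rw [← hA.resolventH_map_star]
    rfl
  rw [hA.logS_conjTranspose, hA.logS_eq, h, bandIntegral_transpose,
    bandIntegral_comp_neg, Matrix.transpose_smul]

theorem resolventH_fromBlocks (hA : IsHurwitz A) (hA' : IsHurwitz A') (ν : ℝ) :
    resolventH (Matrix.fromBlocks A 0 0 A') ν =
      Matrix.fromBlocks (resolventH A ν) 0 0 (resolventH A' ν) := by
  refine Matrix.inv_eq_right_inv ?_
  have h := Matrix.mul_nonsing_inv _ ((Matrix.isUnit_iff_isUnit_det _).1 (hA.isUnit_sub ν))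
  have h' := Matrix.mul_nonsing_inv _ ((Matrix.isUnit_iff_isUnit_det _).1 (hA'.isUnit_sub ν))
  rw [toC_fromBlocks, ← Matrix.fromBlocks_one, Matrix.fromBlocks_smul, sub_eq_add_neg,
    Matrix.fromBlocks_neg, Matrix.fromBlocks_add, Matrix.fromBlocks_multiply]
  simp only [smul_zero, neg_zero, add_zero, zero_add, Matrix.zero_mul, Matrix.mul_zero,
    ← sub_eq_add_neg]
  rw [resolventH, resolventH, h, h']

theorem logS_fromBlocks (hA : IsHurwitz A) (hA' : IsHurwitz A') (ω : ℝ) :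
    logS ω (Matrix.fromBlocks A 0 0 A') = Matrix.fromBlocks (logS ω A) 0 0 (logS ω A') := by
  rw [(hA.fromBlocks hA').logS_eq, hA.logS_eq, hA'.logS_eq]
  rw [show resolventH (Matrix.fromBlocks A 0 0 A') = _ from
    funext fun ν => resolventH_fromBlocks hA hA' ν, bandIntegral_fromBlocks,
    Matrix.fromBlocks_smul, bandIntegral_const, bandIntegral_const]
  simp

/-- Reversing the factors of a real cross Gramian integrand transposes the integral. -/
theorem bandIntegral_ctrl_transpose (hA : IsHurwitz A) (hA' : IsHurwitz A') (ω : ℝ)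
    (M : Matrix n r ℝ) :
    bandIntegral ω (fun ν => resolventH A' ν * toC Mᵀ * (resolventH A ν)ᴴ) =
      (bandIntegral ω (fun ν => resolventH A ν * toC M * (resolventH A' ν)ᴴ))ᵀ := by
  have h : ∀ ν, resolventH A' ν * toC Mᵀ * (resolventH A ν)ᴴ
      = ((resolventH A (-ν) * toC M * (resolventH A' (-ν))ᴴ))ᵀ := by
    -- Conjugating the real-data integrand amounts to `ν ↦ -ν`, so the transpose at `-ν` is the
    -- conjugate transpose at `ν`; the sign change disappears on integration.
    intro ν
    rw [← hA.resolventH_map_star, ← hA'.resolventH_conjTranspose_map_star, ← toC_map_star M,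
      ← map_star_mul, ← map_star_mul, toC_transpose, ← toC_conjTranspose]
    change _ = (resolventH A ν * toC M * (resolventH A' ν)ᴴ)ᴴ
    simp [Matrix.mul_assoc]
  simp only [h]
  rw [bandIntegral_transpose,
    bandIntegral_comp_neg (F := fun ν => resolventH A ν * toC M * (resolventH A' ν)ᴴ)]

theorem bandIntegral_obs_transpose (hA : IsHurwitz A) (hA' : IsHurwitz A') (ω : ℝ)
    (M : Matrix n r ℝ) :
    bandIntegral ω (fun ν => (resolventH A' ν)ᴴ * toC Mᵀ * resolventH A ν) =
      (bandIntegral ω (fun ν => (resolventH A ν)ᴴ * toC M * resolventH A' ν))ᵀ := by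
  have h : ∀ ν, (resolventH A' ν)ᴴ * toC Mᵀ * resolventH A ν
      = (((resolventH A (-ν))ᴴ * toC M * resolventH A' (-ν)))ᵀ := by
    intro ν
    rw [← hA'.resolventH_map_star, ← hA.resolventH_conjTranspose_map_star, ← toC_map_star M,
      ← map_star_mul, ← map_star_mul, toC_transpose, ← toC_conjTranspose]
    change _ = ((resolventH A ν)ᴴ * toC M * resolventH A' ν)ᴴ
    simp [Matrix.mul_assoc]
  simp only [h]
  rw [bandIntegral_transpose,
    bandIntegral_comp_neg (F := fun ν => (resolventH A ν)ᴴ * toC M * resolventH A' ν)]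

end Equations

/-! ### The frequency-limited norm of one system. -/

section Norm

variable {m p : Type*} [Fintype m] [Fintype p]

open scoped ComplexOrder in
theorem trace_mul_conjTranspose_eq_ofReal (M : Matrix p m ℂ) :
    (M * Mᴴ).trace = ((M * Mᴴ).trace.re : ℂ) ∧ 0 ≤ (M * Mᴴ).trace.re := by
  have h := (Matrix.posSemidef_self_mul_conjTranspose M).trace_nonneg
  rw [Complex.le_def] at h
  exact ⟨Complex.ext rfl (by simpa using h.2.symm), h.1⟩

/-- The real part and the square root in `freqNorm` lose nothing: `tr F Fᴴ` is real and nonnegative,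
and `0 ≤ ω` orients the interval so that its integral is too. -/
theorem freqNorm_sq {ω : ℝ} (hω : 0 ≤ ω) {F : ℂ → Matrix p m ℂ}
    (hF : Continuous fun ν : ℝ => F (Complex.I * (ν : ℂ))) :
    ((freqNorm ω F : ℂ)) ^ 2 = 1 / (2 * (Real.pi : ℂ)) * (bandIntegral ω fun ν : ℝ =>
      F (Complex.I * (ν : ℂ)) * (F (Complex.I * (ν : ℂ)))ᴴ).trace := by
  have h : (bandIntegral ω fun ν : ℝ =>
      F (Complex.I * (ν : ℂ)) * (F (Complex.I * (ν : ℂ)))ᴴ).trace =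
      ((∫ ν in (-ω)..ω, (F (Complex.I * (ν : ℂ)) * (F (Complex.I * (ν : ℂ)))ᴴ).trace.re : ℝ) :
        ℂ) := by
    rw [bandIntegral_trace (hF.matrix_mul hF.matrix_conjTranspose),
      ← intervalIntegral.integral_ofReal]
    simp only [← (trace_mul_conjTranspose_eq_ofReal _).1]
  have h0 : 0 ≤ ∫ ν in (-ω)..ω,
      (F (Complex.I * (ν : ℂ)) * (F (Complex.I * (ν : ℂ)))ᴴ).trace.re :=
    intervalIntegral.integral_nonneg (by linarith)
      fun ν _ => (trace_mul_conjTranspose_eq_ofReal _).2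
  rw [freqNorm, h, Complex.ofReal_re, ← Complex.ofReal_pow, Real.sq_sqrt (by positivity)]
  push_cast
  rfl

theorem freqNorm_congr (ω : ℝ) {F K : ℂ → Matrix p m ℂ}
    (h : ∀ ν : ℝ, F (Complex.I * (ν : ℂ)) = K (Complex.I * (ν : ℂ))) :
    freqNorm ω F = freqNorm ω K := by
  simp only [freqNorm, h]

variable {n : Type*} [Fintype n] [DecidableEq n] {G : LTISystem n m p} {ω : ℝ}

namespace LTISystem

omit [Fintype p] [Fintype m] in
theorem transfer_I (G : LTISystem n m p) (ν : ℝ) :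
    G.transfer (Complex.I * (ν : ℂ)) = toC G.C * resolventH G.A ν * toC G.B + toC G.D := rfl

omit [Fintype p] [Fintype m] in
theorem transfer_I_conjTranspose (G : LTISystem n m p) (ν : ℝ) :
    (G.transfer (Complex.I * (ν : ℂ)))ᴴ =
      (toC G.B)ᵀ * (resolventH G.A ν)ᴴ * (toC G.C)ᵀ + (toC G.D)ᵀ := by
  rw [transfer_I]
  simp [toC_conjTranspose, Matrix.mul_assoc]

omit [Fintype p] [Fintype m] in
theorem IsStable.continuous_transfer (hG : G.IsStable) :
    Continuous fun ν : ℝ => G.transfer (Complex.I * (ν : ℂ)) :=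
  ((continuous_const.matrix_mul (IsHurwitz.continuous_resolventH hG)).matrix_mul
    continuous_const).add continuous_const

theorem IsStable.trace_logS_conjTranspose (hG : G.IsStable) :
    (toC G.D * (toC G.B)ᵀ * (logS ω G.A)ᴴ * (toC G.C)ᵀ).trace =
      (toC G.C * logS ω G.A * (toC G.B * (toC G.D)ᵀ)).trace := by
  rw [IsHurwitz.logS_conjTranspose_eq_transpose hG, ← Matrix.trace_transpose]
  simp [Matrix.mul_assoc]

theorem IsStable.freqNorm_sq_ctrl (hG : G.IsStable) (hω : 0 ≤ ω) :
    ((freqNorm ω G.transfer : ℂ) ^ 2 =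
      (toC G.C * G.ctrlGramian ω * (toC G.C)ᵀ).trace
        + 2 * ((toC G.C * logS ω G.A * toC G.B
            + ((ω : ℂ) / (2 * (Real.pi : ℂ))) • toC G.D) * (toC G.D)ᵀ).trace) := by
  have hA : IsHurwitz G.A := hG
  have hH := hA.continuous_resolventH
  have hH' := hA.continuous_conjTranspose_resolventH
  have c0 : Continuous fun ν => resolventH G.A ν * toC G.B * (toC G.B)ᵀ * (resolventH G.A ν)ᴴ :=
    ((hH.matrix_mul continuous_const).matrix_mul continuous_const).matrix_mul hH'
  have c1 : Continuous fun ν => toC G.C *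
      (resolventH G.A ν * toC G.B * (toC G.B)ᵀ * (resolventH G.A ν)ᴴ) :=
    continuous_const.matrix_mul c0
  have c2 : Continuous fun ν => toC G.C * resolventH G.A ν := continuous_const.matrix_mul hH
  have c3 : Continuous fun ν => toC G.D * (toC G.B)ᵀ * (resolventH G.A ν)ᴴ :=
    continuous_const.matrix_mul hH'
  have c1' := c1.matrix_mul (continuous_const (y := (toC G.C)ᵀ))
  have c2' := c2.matrix_mul (continuous_const (y := toC G.B * (toC G.D)ᵀ))
  have c3' := c3.matrix_mul (continuous_const (y := (toC G.C)ᵀ))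
  have h : (fun ν : ℝ => G.transfer (Complex.I * (ν : ℂ)) * (G.transfer (Complex.I * (ν : ℂ)))ᴴ)
      = fun ν => toC G.C *
        (resolventH G.A ν * toC G.B * (toC G.B)ᵀ * (resolventH G.A ν)ᴴ) * (toC G.C)ᵀ
        + toC G.C * resolventH G.A ν * (toC G.B * (toC G.D)ᵀ)
        + toC G.D * (toC G.B)ᵀ * (resolventH G.A ν)ᴴ * (toC G.C)ᵀ
        + toC G.D * (toC G.D)ᵀ := by
    funext ν
    rw [transfer_I_conjTranspose, transfer_I]
    simp only [Matrix.mul_add, Matrix.add_mul, Matrix.mul_assoc]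
    abel
  rw [freqNorm_sq hω hG.continuous_transfer, h,
    bandIntegral_add ((c1'.fun_add c2').fun_add c3') continuous_const, bandIntegral_add (c1'.fun_add c2') c3',
    bandIntegral_add c1' c2', bandIntegral_mul_right _ c1, bandIntegral_mul_left _ c0,
    bandIntegral_mul_right _ c2, bandIntegral_mul_left _ hH, bandIntegral_mul_right _ c3,
    bandIntegral_mul_left _ hH', bandIntegral_const]
  -- This merges the two mixed terms into one doubled trace; the constant term `D Dᵀ` integrates to
  -- `2ω D Dᵀ`, whence `2 · ω/(2π)`.
  have h3 := hG.trace_logS_conjTranspose (ω := ω)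
  rw [hA.logS_conjTranspose] at h3
  rw [hA.logS_eq] at h3 ⊢
  rw [ctrlGramian]
  simp only [Matrix.trace_add, Matrix.trace_smul, Matrix.mul_smul, Matrix.smul_mul,
    Matrix.add_mul, smul_eq_mul] at h3 ⊢
  rw [Matrix.mul_assoc _ (toC G.B)]
  linear_combination h3

theorem IsStable.freqNorm_sq_obs (hG : G.IsStable) (hω : 0 ≤ ω) :
    ((freqNorm ω G.transfer : ℂ) ^ 2 =
      ((toC G.B)ᵀ * G.obsGramian ω * toC G.B).trace
        + 2 * ((toC G.C * logS ω G.A * toC G.B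
            + ((ω : ℂ) / (2 * (Real.pi : ℂ))) • toC G.D) * (toC G.D)ᵀ).trace) := by
  have hA : IsHurwitz G.A := hG
  have hH := hA.continuous_resolventH
  have hH' := hA.continuous_conjTranspose_resolventH
  have c0 : Continuous fun ν => (resolventH G.A ν)ᴴ * (toC G.C)ᵀ * toC G.C * resolventH G.A ν :=
    ((hH'.matrix_mul continuous_const).matrix_mul continuous_const).matrix_mul hH
  have c1 : Continuous fun ν => (toC G.B)ᵀ *
      ((resolventH G.A ν)ᴴ * (toC G.C)ᵀ * toC G.C * resolventH G.A ν) :=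
    continuous_const.matrix_mul c0
  have c2 : Continuous fun ν => (toC G.D)ᵀ * toC G.C * resolventH G.A ν :=
    continuous_const.matrix_mul hH
  have c3 : Continuous fun ν => (toC G.B)ᵀ * (resolventH G.A ν)ᴴ :=
    continuous_const.matrix_mul hH'
  have c1' := c1.matrix_mul (continuous_const (y := toC G.B))
  have c2' := c2.matrix_mul (continuous_const (y := toC G.B))
  have c3' := c3.matrix_mul (continuous_const (y := (toC G.C)ᵀ * toC G.D))
  have h : (fun ν : ℝ => (G.transfer (Complex.I * (ν : ℂ)))ᴴ * G.transfer (Complex.I * (ν : ℂ)))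
      = fun ν => (toC G.B)ᵀ *
        ((resolventH G.A ν)ᴴ * (toC G.C)ᵀ * toC G.C * resolventH G.A ν) * toC G.B
        + (toC G.D)ᵀ * toC G.C * resolventH G.A ν * toC G.B
        + (toC G.B)ᵀ * (resolventH G.A ν)ᴴ * ((toC G.C)ᵀ * toC G.D)
        + (toC G.D)ᵀ * toC G.D := by
    funext ν
    rw [transfer_I_conjTranspose, transfer_I]
    simp only [Matrix.mul_add, Matrix.add_mul, Matrix.mul_assoc]
    abel
  have hT := hG.continuous_transfer
  -- Passing to `Gᴴ G` puts `Cᵀ C` between the resolvents, as in `Q_ω`.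
  have hcyc : (bandIntegral ω fun ν : ℝ =>
      G.transfer (Complex.I * (ν : ℂ)) * (G.transfer (Complex.I * (ν : ℂ)))ᴴ).trace =
      (bandIntegral ω fun ν : ℝ =>
        (G.transfer (Complex.I * (ν : ℂ)))ᴴ * G.transfer (Complex.I * (ν : ℂ))).trace := by
    rw [bandIntegral_trace (hT.matrix_mul hT.matrix_conjTranspose),
      bandIntegral_trace (hT.matrix_conjTranspose.matrix_mul hT)]
    simp only [Matrix.trace_mul_comm (G.transfer _)]
  rw [freqNorm_sq hω hT, hcyc, h,
    bandIntegral_add ((c1'.fun_add c2').fun_add c3') continuous_const, bandIntegral_add (c1'.fun_add c2') c3',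
    bandIntegral_add c1' c2', bandIntegral_mul_right _ c1, bandIntegral_mul_left _ c0,
    bandIntegral_mul_right _ c2, bandIntegral_mul_left _ hH, bandIntegral_mul_right _ c3,
    bandIntegral_mul_left _ hH', bandIntegral_const]
  have h3 := hG.trace_logS_conjTranspose (ω := ω)
  have h4 : ((toC G.B)ᵀ * (logS ω G.A)ᴴ * ((toC G.C)ᵀ * toC G.D)).trace =
      (toC G.D * (toC G.B)ᵀ * (logS ω G.A)ᴴ * (toC G.C)ᵀ).trace := by
    rw [← Matrix.mul_assoc, Matrix.trace_mul_comm]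
    simp only [Matrix.mul_assoc]
  have h5 : ((toC G.D)ᵀ * toC G.C * logS ω G.A * toC G.B).trace =
      (toC G.C * logS ω G.A * (toC G.B * (toC G.D)ᵀ)).trace := by
    rw [Matrix.mul_assoc, Matrix.mul_assoc, Matrix.trace_mul_comm]
    simp only [Matrix.mul_assoc]
  rw [h3, hA.logS_conjTranspose] at h4
  rw [hA.logS_eq] at h4 h5 ⊢
  rw [obsGramian]
  simp only [Matrix.trace_add, Matrix.trace_smul, Matrix.mul_smul, Matrix.smul_mul,
    Matrix.add_mul, smul_eq_mul] at h4 h5 ⊢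
  rw [Matrix.mul_assoc _ (toC G.B), Matrix.trace_mul_comm (toC G.D)ᵀ]
  linear_combination h4 + h5

end LTISystem

end Norm

end FreqLim

/-! ### The error system in block form. -/

namespace FreqLim
namespace LTISystem

variable {n r m p : Type*} [Fintype n] [DecidableEq n] [Fintype r] [DecidableEq r]
  {G : LTISystem n m p} {Gr : LTISystem r m p}

theorem IsStable.errorSystem (hG : G.IsStable) (hGr : Gr.IsStable) :
    (G.errorSystem Gr).IsStable :=
  IsHurwitz.fromBlocks hG hGr

omit [Fintype n] [DecidableEq n] [Fintype r] [DecidableEq r] in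
theorem toC_errorSystem_B : toC (G.errorSystem Gr).B = Matrix.fromRows (toC G.B) (toC Gr.B) :=
  toC_fromRows _ _

omit [Fintype n] [DecidableEq n] [Fintype r] [DecidableEq r] in
theorem toC_errorSystem_C : toC (G.errorSystem Gr).C = Matrix.fromCols (toC G.C) (-toC Gr.C) :=
  toC_fromCols_neg _ _

omit [Fintype n] [DecidableEq n] [Fintype r] [DecidableEq r] in
theorem toC_errorSystem_D : toC (G.errorSystem Gr).D = toC G.D - toC Gr.D :=
  toC_sub _ _

theorem resolventH_errorSystem (hG : G.IsStable) (hGr : Gr.IsStable) (ν : ℝ) :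
    resolventH (G.errorSystem Gr).A ν =
      Matrix.fromBlocks (resolventH G.A ν) 0 0 (resolventH Gr.A ν) :=
  resolventH_fromBlocks hG hGr ν

theorem logS_errorSystem (hG : G.IsStable) (hGr : Gr.IsStable) (ω : ℝ) :
    logS ω (G.errorSystem Gr).A = Matrix.fromBlocks (logS ω G.A) 0 0 (logS ω Gr.A) :=
  logS_fromBlocks hG hGr ω

theorem transfer_errorSystem (hG : G.IsStable) (hGr : Gr.IsStable) (ν : ℝ) :
    (G.errorSystem Gr).transfer (Complex.I * (ν : ℂ)) =
      G.transfer (Complex.I * (ν : ℂ)) - Gr.transfer (Complex.I * (ν : ℂ)) := by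
  rw [transfer_I, transfer_I, transfer_I, toC_errorSystem_B, toC_errorSystem_C,
    toC_errorSystem_D, resolventH_errorSystem hG hGr, Matrix.fromCols_mul_fromBlocks,
    Matrix.fromCols_mul_fromRows]
  simp only [Matrix.mul_zero, add_zero, zero_add, Matrix.neg_mul]
  abel

section Ctrl

variable [Fintype m]

theorem ctrlGramian_errorSystem_eq (hG : G.IsStable) (hGr : Gr.IsStable) (ω : ℝ) :
    (G.errorSystem Gr).ctrlGramian ω = Matrix.fromBlocks (G.ctrlGramian ω)
      ((1 / (2 * (Real.pi : ℂ))) • bandIntegral ω fun ν =>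
        resolventH G.A ν * (toC G.B * (toC Gr.B)ᵀ) * (resolventH Gr.A ν)ᴴ)
      ((1 / (2 * (Real.pi : ℂ))) • bandIntegral ω fun ν =>
        resolventH Gr.A ν * (toC Gr.B * (toC G.B)ᵀ) * (resolventH G.A ν)ᴴ)
      (Gr.ctrlGramian ω) := by
  have h : (fun ν => resolventH (G.errorSystem Gr).A ν * toC (G.errorSystem Gr).B *
      (toC (G.errorSystem Gr).B)ᵀ * (resolventH (G.errorSystem Gr).A ν)ᴴ) =
      fun ν => Matrix.fromBlocks
        (resolventH G.A ν * toC G.B * (toC G.B)ᵀ * (resolventH G.A ν)ᴴ)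
        (resolventH G.A ν * (toC G.B * (toC Gr.B)ᵀ) * (resolventH Gr.A ν)ᴴ)
        (resolventH Gr.A ν * (toC Gr.B * (toC G.B)ᵀ) * (resolventH G.A ν)ᴴ)
        (resolventH Gr.A ν * toC Gr.B * (toC Gr.B)ᵀ * (resolventH Gr.A ν)ᴴ) := by
    funext ν
    rw [resolventH_errorSystem hG hGr, toC_errorSystem_B, Matrix.transpose_fromRows,
      Matrix.mul_assoc (Matrix.fromBlocks _ _ _ _), Matrix.fromRows_mul_fromCols,
      Matrix.fromBlocks_conjTranspose, Matrix.fromBlocks_multiply, Matrix.fromBlocks_multiply]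
    simp [Matrix.mul_assoc]
  rw [ctrlGramian, h, bandIntegral_fromBlocks, Matrix.fromBlocks_smul]
  rfl

theorem crossX_eq (hG : G.IsStable) (hGr : Gr.IsStable) (ω : ℝ) :
    G.crossX Gr ω = (1 / (2 * (Real.pi : ℂ))) • bandIntegral ω fun ν =>
      resolventH G.A ν * (toC G.B * (toC Gr.B)ᵀ) * (resolventH Gr.A ν)ᴴ := by
  rw [crossX, ctrlGramian_errorSystem_eq hG hGr, Matrix.toBlocks_fromBlocks₁₂]

theorem ctrlGramian_errorSystem (hG : G.IsStable) (hGr : Gr.IsStable) (ω : ℝ) :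
    (G.errorSystem Gr).ctrlGramian ω = Matrix.fromBlocks (G.ctrlGramian ω) (G.crossX Gr ω)
      (G.crossX Gr ω)ᵀ (Gr.ctrlGramian ω) := by
  have h := bandIntegral_ctrl_transpose hG hGr ω (G.B * Gr.Bᵀ)
  have h1 : toC (G.B * Gr.Bᵀ) = toC G.B * (toC Gr.B)ᵀ := toC_mul _ _
  rw [toC_transpose, h1, Matrix.transpose_mul, Matrix.transpose_transpose] at h
  rw [ctrlGramian_errorSystem_eq hG hGr, crossX_eq hG hGr, h, Matrix.transpose_smul]

theorem IsStable.ctrlGramian_iff (hG : G.IsStable) (ω : ℝ) (Z : Matrix n n ℂ) :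
    toC G.A * Z + Z * (toC G.A)ᵀ + logS ω G.A * toC G.B * (toC G.B)ᵀ
      + toC G.B * (toC G.B)ᵀ * (logS ω G.A)ᴴ = 0 ↔ Z = G.ctrlGramian ω := by
  have h := ctrl_sylvester_iff hG hG ω (toC G.B * (toC G.B)ᵀ) Z
  simp only [← Matrix.mul_assoc, ← add_assoc] at h
  exact h

theorem crossX_iff (hG : G.IsStable) (hGr : Gr.IsStable) (ω : ℝ) (Z : Matrix n r ℂ) :
    toC G.A * Z + Z * (toC Gr.A)ᵀ + logS ω G.A * toC G.B * (toC Gr.B)ᵀ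
      + toC G.B * (toC Gr.B)ᵀ * (logS ω Gr.A)ᴴ = 0 ↔ Z = G.crossX Gr ω := by
  have h := ctrl_sylvester_iff hG hGr ω (toC G.B * (toC Gr.B)ᵀ) Z
  rw [← crossX_eq hG hGr] at h
  simp only [← Matrix.mul_assoc, ← add_assoc] at h
  exact h

theorem trace_ctrl_errorSystem [Fintype p] (hG : G.IsStable) (hGr : Gr.IsStable) (ω : ℝ) :
    (toC (G.errorSystem Gr).C * (G.errorSystem Gr).ctrlGramian ω
      * (toC (G.errorSystem Gr).C)ᵀ).trace =
    (toC G.C * G.ctrlGramian ω * (toC G.C)ᵀ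
      - (2 : ℂ) • (toC G.C * G.crossX Gr ω * (toC Gr.C)ᵀ)
      + toC Gr.C * Gr.ctrlGramian ω * (toC Gr.C)ᵀ).trace := by
  have h : (toC Gr.C * (G.crossX Gr ω)ᵀ * (toC G.C)ᵀ).trace =
      (toC G.C * G.crossX Gr ω * (toC Gr.C)ᵀ).trace := by
    rw [← Matrix.trace_transpose]
    simp [Matrix.mul_assoc]
  rw [ctrlGramian_errorSystem hG hGr, toC_errorSystem_C, Matrix.transpose_fromCols,
    Matrix.fromCols_mul_fromBlocks, Matrix.fromCols_mul_fromRows]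
  simp only [Matrix.transpose_neg, Matrix.neg_mul, Matrix.mul_neg, Matrix.add_mul,
    Matrix.trace_add, Matrix.trace_sub, Matrix.trace_neg, Matrix.trace_smul, h, smul_eq_mul]
  ring

end Ctrl

section Obs

variable [Fintype p]

theorem obsGramian_errorSystem_eq (hG : G.IsStable) (hGr : Gr.IsStable) (ω : ℝ) :
    (G.errorSystem Gr).obsGramian ω = Matrix.fromBlocks (G.obsGramian ω)
      ((1 / (2 * (Real.pi : ℂ))) • bandIntegral ω fun ν =>
        (resolventH G.A ν)ᴴ * (-((toC G.C)ᵀ * toC Gr.C)) * resolventH Gr.A ν)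
      ((1 / (2 * (Real.pi : ℂ))) • bandIntegral ω fun ν =>
        (resolventH Gr.A ν)ᴴ * (-((toC Gr.C)ᵀ * toC G.C)) * resolventH G.A ν)
      (Gr.obsGramian ω) := by
  have h : (fun ν => (resolventH (G.errorSystem Gr).A ν)ᴴ * (toC (G.errorSystem Gr).C)ᵀ *
      toC (G.errorSystem Gr).C * resolventH (G.errorSystem Gr).A ν) =
      fun ν => Matrix.fromBlocks
        ((resolventH G.A ν)ᴴ * (toC G.C)ᵀ * toC G.C * resolventH G.A ν)
        ((resolventH G.A ν)ᴴ * (-((toC G.C)ᵀ * toC Gr.C)) * resolventH Gr.A ν)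
        ((resolventH Gr.A ν)ᴴ * (-((toC Gr.C)ᵀ * toC G.C)) * resolventH G.A ν)
        ((resolventH Gr.A ν)ᴴ * (toC Gr.C)ᵀ * toC Gr.C * resolventH Gr.A ν) := by
    funext ν
    rw [resolventH_errorSystem hG hGr, toC_errorSystem_C, Matrix.transpose_fromCols,
      Matrix.mul_assoc (Matrix.fromBlocks _ _ _ _)ᴴ, Matrix.fromRows_mul_fromCols,
      Matrix.fromBlocks_conjTranspose, Matrix.fromBlocks_multiply, Matrix.fromBlocks_multiply]
    simp [Matrix.mul_assoc]
  rw [obsGramian, h, bandIntegral_fromBlocks, Matrix.fromBlocks_smul]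
  rfl

theorem crossY_eq (hG : G.IsStable) (hGr : Gr.IsStable) (ω : ℝ) :
    G.crossY Gr ω = (1 / (2 * (Real.pi : ℂ))) • bandIntegral ω fun ν =>
      (resolventH G.A ν)ᴴ * (-((toC G.C)ᵀ * toC Gr.C)) * resolventH Gr.A ν := by
  rw [crossY, obsGramian_errorSystem_eq hG hGr, Matrix.toBlocks_fromBlocks₁₂]

theorem obsGramian_errorSystem (hG : G.IsStable) (hGr : Gr.IsStable) (ω : ℝ) :
    (G.errorSystem Gr).obsGramian ω = Matrix.fromBlocks (G.obsGramian ω) (G.crossY Gr ω)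
      (G.crossY Gr ω)ᵀ (Gr.obsGramian ω) := by
  -- The minus sign comes from the block `-Ĉ` of `C_E`; it is carried by `Y_ω`.
  have h := bandIntegral_obs_transpose hG hGr ω (-(G.Cᵀ * Gr.C))
  have h1 : toC (-(G.Cᵀ * Gr.C)) = -((toC G.C)ᵀ * toC Gr.C) := by
    rw [toC_neg, toC_mul, toC_transpose]
  rw [toC_transpose, h1, Matrix.transpose_neg, Matrix.transpose_mul,
    Matrix.transpose_transpose] at h
  rw [obsGramian_errorSystem_eq hG hGr, crossY_eq hG hGr, h, Matrix.transpose_smul]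

theorem IsStable.obsGramian_iff (hG : G.IsStable) (ω : ℝ) (Z : Matrix n n ℂ) :
    (toC G.A)ᵀ * Z + Z * toC G.A + (logS ω G.A)ᴴ * (toC G.C)ᵀ * toC G.C
      + (toC G.C)ᵀ * toC G.C * logS ω G.A = 0 ↔ Z = G.obsGramian ω := by
  have h := obs_sylvester_iff hG hG ω ((toC G.C)ᵀ * toC G.C) Z
  simp only [← Matrix.mul_assoc, ← add_assoc] at h
  exact h

theorem crossY_iff (hG : G.IsStable) (hGr : Gr.IsStable) (ω : ℝ) (Z : Matrix n r ℂ) :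
    (toC G.A)ᵀ * Z + Z * toC Gr.A - (logS ω G.A)ᴴ * (toC G.C)ᵀ * toC Gr.C
      - (toC G.C)ᵀ * toC Gr.C * logS ω Gr.A = 0 ↔ Z = G.crossY Gr ω := by
  have h := obs_sylvester_iff hG hGr ω (-((toC G.C)ᵀ * toC Gr.C)) Z
  rw [← crossY_eq hG hGr] at h
  simp only [← Matrix.mul_assoc, ← add_assoc, Matrix.mul_neg, Matrix.neg_mul] at h
  simp only [← sub_eq_add_neg] at h
  exact h

theorem trace_obs_errorSystem [Fintype m] (hG : G.IsStable) (hGr : Gr.IsStable) (ω : ℝ) :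
    ((toC (G.errorSystem Gr).B)ᵀ * (G.errorSystem Gr).obsGramian ω
      * toC (G.errorSystem Gr).B).trace =
    ((toC G.B)ᵀ * G.obsGramian ω * toC G.B
      + (2 : ℂ) • ((toC G.B)ᵀ * G.crossY Gr ω * toC Gr.B)
      + (toC Gr.B)ᵀ * Gr.obsGramian ω * toC Gr.B).trace := by
  have h : ((toC Gr.B)ᵀ * (G.crossY Gr ω)ᵀ * toC G.B).trace =
      ((toC G.B)ᵀ * G.crossY Gr ω * toC Gr.B).trace := by
    rw [← Matrix.trace_transpose]
    simp [Matrix.mul_assoc]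
  rw [obsGramian_errorSystem hG hGr, toC_errorSystem_B, Matrix.transpose_fromRows,
    Matrix.fromCols_mul_fromBlocks, Matrix.fromCols_mul_fromRows]
  simp only [Matrix.add_mul, Matrix.trace_add, Matrix.trace_smul, h, smul_eq_mul]
  ring

end Obs

theorem errorSystem_feedthrough [Fintype m] (hG : G.IsStable) (hGr : Gr.IsStable) (ω : ℝ) :
    (toC (G.errorSystem Gr).C * logS ω (G.errorSystem Gr).A * toC (G.errorSystem Gr).B
        + ((ω : ℂ) / (2 * (Real.pi : ℂ))) • toC (G.errorSystem Gr).D)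
      * (toC (G.errorSystem Gr).D)ᵀ =
    (toC G.C * logS ω G.A * toC G.B + ((ω : ℂ) / (2 * (Real.pi : ℂ))) • toC G.D
        - (toC Gr.C * logS ω Gr.A * toC Gr.B
          + ((ω : ℂ) / (2 * (Real.pi : ℂ))) • toC Gr.D))
      * ((toC G.D)ᵀ - (toC Gr.D)ᵀ) := by
  rw [logS_errorSystem hG hGr, toC_errorSystem_B, toC_errorSystem_C, toC_errorSystem_D,
    Matrix.fromCols_mul_fromBlocks, Matrix.fromCols_mul_fromRows, Matrix.transpose_sub]
  congr 1
  simp only [Matrix.mul_zero, add_zero, zero_add, Matrix.neg_mul, smul_sub]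
  abel

end LTISystem
end FreqLim

/-! ### Assembly of the theorem. -/

open FreqLim in
theorem mainTheorem3 {n m p : Type*} [Fintype n] [DecidableEq n] [Fintype m] [Fintype p]
    (ω : ℝ) (hω : 0 ≤ ω) (G : LTISystem n m p) (hG : G.IsStable) :
    -- the logarithm in `S_ω` is well defined
    (∃! L, IsPrincipalLog (cayley ω G.A) L) ∧
    -- `P_ω` is the unique solution of its Lyapunov equation
    (∀ Z : Matrix n n ℂ,
      toC G.A * Z + Z * (toC G.A)ᵀ + logS ω G.A * toC G.B * (toC G.B)ᵀ
          + toC G.B * (toC G.B)ᵀ * (logS ω G.A)ᴴ = 0 ↔ Z = G.ctrlGramian ω) ∧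
    -- the three expressions for the squared frequency-limited norm of `G`
    ((freqNorm ω G.transfer : ℂ) ^ 2 =
      1 / (2 * (Real.pi : ℂ)) * (bandIntegral ω fun ν : ℝ =>
        G.transfer (Complex.I * (ν : ℂ)) * (G.transfer (Complex.I * (ν : ℂ)))ᴴ).trace) ∧
    ((freqNorm ω G.transfer : ℂ) ^ 2 =
      1 / (2 * (Real.pi : ℂ)) * (bandIntegral ω fun ν : ℝ =>
        (toC G.C * resolventH G.A ν * toC G.B + toC G.D) *
          ((toC G.B)ᵀ * (resolventH G.A ν)ᴴ * (toC G.C)ᵀ + (toC G.D)ᵀ)).trace) ∧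
    ((freqNorm ω G.transfer : ℂ) ^ 2 =
      (toC G.C * G.ctrlGramian ω * (toC G.C)ᵀ).trace
        + 2 * ((toC G.C * logS ω G.A * toC G.B
            + ((ω : ℂ) / (2 * (Real.pi : ℂ))) • toC G.D) * (toC G.D)ᵀ).trace) ∧
    -- the error system of `G` and a second stable system `Gr` with the same inputs and outputs
    (∀ {r : Type*} [Fintype r] [DecidableEq r] (Gr : LTISystem r m p), Gr.IsStable →
      -- the block-diagonal realization realizes the difference
      (∀ ν : ℝ, (G.errorSystem Gr).transfer (Complex.I * (ν : ℂ)) =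
        G.transfer (Complex.I * (ν : ℂ)) - Gr.transfer (Complex.I * (ν : ℂ))) ∧
      -- block forms of the Gramians and of `S`
      (G.errorSystem Gr).ctrlGramian ω =
        Matrix.fromBlocks (G.ctrlGramian ω) (G.crossX Gr ω)
          (G.crossX Gr ω)ᵀ (Gr.ctrlGramian ω) ∧
      (G.errorSystem Gr).obsGramian ω =
        Matrix.fromBlocks (G.obsGramian ω) (G.crossY Gr ω)
          (G.crossY Gr ω)ᵀ (Gr.obsGramian ω) ∧
      (∃! L, IsPrincipalLog (cayley ω (G.errorSystem Gr).A) L) ∧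
      (∃! L, IsPrincipalLog (cayley ω Gr.A) L) ∧
      logS ω (G.errorSystem Gr).A =
        Matrix.fromBlocks (logS ω G.A) 0 0 (logS ω Gr.A) ∧
      -- the blocks are the unique solutions of the Lyapunov and Sylvester equations
      (∀ Z : Matrix n r ℂ,
        toC G.A * Z + Z * (toC Gr.A)ᵀ + logS ω G.A * toC G.B * (toC Gr.B)ᵀ
            + toC G.B * (toC Gr.B)ᵀ * (logS ω Gr.A)ᴴ = 0 ↔ Z = G.crossX Gr ω) ∧
      (∀ Z : Matrix r r ℂ,
        toC Gr.A * Z + Z * (toC Gr.A)ᵀ + logS ω Gr.A * toC Gr.B * (toC Gr.B)ᵀ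
            + toC Gr.B * (toC Gr.B)ᵀ * (logS ω Gr.A)ᴴ = 0 ↔ Z = Gr.ctrlGramian ω) ∧
      (∀ Z : Matrix n n ℂ,
        (toC G.A)ᵀ * Z + Z * toC G.A + (logS ω G.A)ᴴ * (toC G.C)ᵀ * toC G.C
            + (toC G.C)ᵀ * toC G.C * logS ω G.A = 0 ↔ Z = G.obsGramian ω) ∧
      (∀ Z : Matrix n r ℂ,
        (toC G.A)ᵀ * Z + Z * toC Gr.A - (logS ω G.A)ᴴ * (toC G.C)ᵀ * toC Gr.C
            - (toC G.C)ᵀ * toC Gr.C * logS ω Gr.A = 0 ↔ Z = G.crossY Gr ω) ∧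
      (∀ Z : Matrix r r ℂ,
        (toC Gr.A)ᵀ * Z + Z * toC Gr.A + (logS ω Gr.A)ᴴ * (toC Gr.C)ᵀ * toC Gr.C
            + (toC Gr.C)ᵀ * toC Gr.C * logS ω Gr.A = 0 ↔ Z = Gr.obsGramian ω) ∧
      -- the squared norm of the error and its expressions through the error realization
      freqNorm ω (G.errorSystem Gr).transfer = freqNorm ω (G.transfer - Gr.transfer) ∧
      ((freqNorm ω (G.transfer - Gr.transfer) : ℂ) ^ 2 =
        1 / (2 * (Real.pi : ℂ)) * (bandIntegral ω fun ν : ℝ =>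
          (G.errorSystem Gr).transfer (Complex.I * (ν : ℂ)) *
            ((G.errorSystem Gr).transfer (Complex.I * (ν : ℂ)))ᴴ).trace) ∧
      ((freqNorm ω (G.transfer - Gr.transfer) : ℂ) ^ 2 =
        (toC (G.errorSystem Gr).C * (G.errorSystem Gr).ctrlGramian ω
            * (toC (G.errorSystem Gr).C)ᵀ).trace
          + 2 * ((toC (G.errorSystem Gr).C * logS ω (G.errorSystem Gr).A
                * toC (G.errorSystem Gr).B
              + ((ω : ℂ) / (2 * (Real.pi : ℂ))) • toC (G.errorSystem Gr).D)
              * (toC (G.errorSystem Gr).D)ᵀ).trace) ∧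
      ((freqNorm ω (G.transfer - Gr.transfer) : ℂ) ^ 2 =
        ((toC (G.errorSystem Gr).B)ᵀ * (G.errorSystem Gr).obsGramian ω
            * toC (G.errorSystem Gr).B).trace
          + 2 * ((toC (G.errorSystem Gr).C * logS ω (G.errorSystem Gr).A
                * toC (G.errorSystem Gr).B
              + ((ω : ℂ) / (2 * (Real.pi : ℂ))) • toC (G.errorSystem Gr).D)
              * (toC (G.errorSystem Gr).D)ᵀ).trace) ∧
      -- the cost in observability form
      ((freqNorm ω (G.transfer - Gr.transfer) : ℂ) ^ 2 =
        ((toC G.B)ᵀ * G.obsGramian ω * toC G.B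
            + (2 : ℂ) • ((toC G.B)ᵀ * G.crossY Gr ω * toC Gr.B)
            + (toC Gr.B)ᵀ * Gr.obsGramian ω * toC Gr.B).trace
          + 2 * ((toC G.C * logS ω G.A * toC G.B
                + ((ω : ℂ) / (2 * (Real.pi : ℂ))) • toC G.D
                - (toC Gr.C * logS ω Gr.A * toC Gr.B
                  + ((ω : ℂ) / (2 * (Real.pi : ℂ))) • toC Gr.D))
              * ((toC G.D)ᵀ - (toC Gr.D)ᵀ)).trace) ∧
      -- the cost in controllability form
      ((freqNorm ω (G.transfer - Gr.transfer) : ℂ) ^ 2 =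
        (toC G.C * G.ctrlGramian ω * (toC G.C)ᵀ
            - (2 : ℂ) • (toC G.C * G.crossX Gr ω * (toC Gr.C)ᵀ)
            + toC Gr.C * Gr.ctrlGramian ω * (toC Gr.C)ᵀ).trace
          + 2 * ((toC G.C * logS ω G.A * toC G.B
                + ((ω : ℂ) / (2 * (Real.pi : ℂ))) • toC G.D
                - (toC Gr.C * logS ω Gr.A * toC Gr.B
                  + ((ω : ℂ) / (2 * (Real.pi : ℂ))) • toC Gr.D))
              * ((toC G.D)ᵀ - (toC Gr.D)ᵀ)).trace)) := by
  refine ⟨IsHurwitz.existsUnique_isPrincipalLog hG ω, hG.ctrlGramian_iff ω,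
    freqNorm_sq hω hG.continuous_transfer, ?_, hG.freqNorm_sq_ctrl hω, ?_⟩
  · rw [freqNorm_sq hω hG.continuous_transfer]
    simp only [LTISystem.transfer_I_conjTranspose]
    simp only [LTISystem.transfer_I]
  intro r _ _ Gr hGr
  have hE := hG.errorSystem hGr
  -- Only values on the imaginary axis matter, where stability makes all inverses genuine. At a pole
  -- the default value `0` of a singular inverse can break the identity of transfer functions.
  have hN : freqNorm ω (G.errorSystem Gr).transfer = freqNorm ω (G.transfer - Gr.transfer) :=
    freqNorm_congr ω fun ν => LTISystem.transfer_errorSystem hG hGr ν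
  refine ⟨LTISystem.transfer_errorSystem hG hGr, LTISystem.ctrlGramian_errorSystem hG hGr ω,
    LTISystem.obsGramian_errorSystem hG hGr ω, IsHurwitz.existsUnique_isPrincipalLog hE ω,
    IsHurwitz.existsUnique_isPrincipalLog hGr ω, LTISystem.logS_errorSystem hG hGr ω,
    LTISystem.crossX_iff hG hGr ω, hGr.ctrlGramian_iff ω, hG.obsGramian_iff ω,
    LTISystem.crossY_iff hG hGr ω, hGr.obsGramian_iff ω, hN, ?_, ?_, ?_, ?_, ?_⟩
  · rw [← hN]
    exact freqNorm_sq hω hE.continuous_transfer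
  · rw [← hN]
    exact hE.freqNorm_sq_ctrl hω
  · rw [← hN]
    exact hE.freqNorm_sq_obs hω
  · rw [← hN, hE.freqNorm_sq_obs hω, LTISystem.trace_obs_errorSystem hG hGr,
      LTISystem.errorSystem_feedthrough hG hGr]
  · rw [← hN, hE.freqNorm_sq_ctrl hω, LTISystem.trace_ctrl_errorSystem hG hGr,
      LTISystem.errorSystem_feedthrough hG hGr]
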